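/- **Setting.** Let $E$ be a locally compact Polish space with Borel $\sigma$-field. Let $\lambda:E\to(0,\infty)$ be bounded and continuous, and let $p(x,dy)$ be a probability kernel on $E$ such that $x\mapsto p(x,A)$ is continuous for every Borel set $A$. Put $W(x,dy)=\lambda(x)\,p(x,dy)$, and let $(X_t)_{t\ge0}$ be the (nonexplosive, càdlàg) pure jump Markov process with transition rates $W(x,dy)$, that is, with generator $\mathcal L f(x)=\int_E W(x,dy)\,[f(y)-f(x)]$, $f\in\mathcal C_b(E)$. Write $\mathbb E_x$, $\mathbb E_{\mu_0}$ for expectations when the process starts from $x\in E$, or from a probability measure $\mu_0$ on $E$. Let $g\in\mathcal C_b(E^2)$ with $g(x,x)=0$ for all $x$, and let $h\in\mathcal C_b(E)$. For $T>0$ set $$A_T=\frac1T\sum_{0<s\le T,\;X_{s-}\ne X_s} g(X_{s-},X_s)+\frac1T\int_0^T h(X_s)\,ds ,$$ with the convention $tA_t=0$ at $t=0$. Fix $k\in\mathbb R$ and a probability measure $\mu_0$ on $E$, and define, for $t\ge 0$, $$P_k(t)f(x)=\mathbb E_x\big[f(X_t)\,e^{ktA_t}\big],\qquad \nu_t(f)=\mu_0\big(P_k(t)f\big),\qquad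 \mu_t(f)=\frac{\nu_t(f)}{\nu_t(1)},$$ $$\mathcal V_k(x)=\int_E W(x,dy)\,e^{kg(x,y)}-\lambda(x)+k\,h(x).$$ **Proposition.** (1) For every $t\ge 0$ the random variable $e^{ktA_t}$ is $\mathbb P_{\mu_0}$-integrable, the function $s\mapsto\mu_s(\mathcal V_k)$ is integrable on $[0,t]$, and $$\log\mathbb E_{\mu_0}\big[e^{ktA_t}\big]=\int_0^t\mu_s(\mathcal V_k)\,ds .$$ (2) Suppose that asymptotic stability holds with $\Lambda_k\in\mathbb R$: there are a strictly positive function $r\in\mathcal C_b(E)$, a probability measure $\mu_\infty$ on $E$ and constants $\alpha>0$, $\rho\in(0,1)$ such that $$\big\|e^{-t\Lambda_k}P_k(t)f-\mu_\infty(f)\,r\big\|_\infty\le\|f\|_\infty\,\alpha\rho^t\qquad\text{for all }t\ge0,\ f\in\mathcal C_b(E).$$ Then $\Lambda_k$ is the scaled cumulant generating function, i.e. $\frac1T\log\mathbb E_{\mu_0}\big[e^{kTA_T}\big]\to\Lambda_k$ as $T\to\infty$, and $$\frac1T\int_0^T\mu_s(\mathcal V_k)\,ds\to\Lambda_k\qquad\text{as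 }T\to\infty .$$ -/

import Mathlib

open MeasureTheory ProbabilityTheory Filter Topology
open scoped BoundedContinuousFunction

noncomputable section

namespace TiltedJump

/-- Transition rates `W(x, dy) = rate x • jump x (dy)` of a (nonexplosive) pure jump process on `E`:
the escape rate is continuous, bounded and strictly positive, the jump distributions form a
probability kernel, and `x ↦ jump x A` is continuous for every Borel set `A`. -/
structure JumpRates (E : Type*) [TopologicalSpace E] [MeasurableSpace E] where
  rate : E →ᵇ ℝ
  rate_pos : ∀ x, 0 < rate x
  jump : Kernel E E
  isMarkov : IsMarkovKernel jump
  continuous_jump : ∀ A : Set E, MeasurableSet A → Continuous fun x => (jump x).real A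

instance expMeasure_one_isProbabilityMeasure : IsProbabilityMeasure (expMeasure 1) :=
  isProbabilityMeasure_expMeasure one_pos

section PathFunctionals

variable {E : Type*} [TopologicalSpace E]

/-- The time-additive observable
`A_T(ω) = (1/T) ∑_{0 < s ≤ T, ω(s-) ≠ ω(s)} g(ω(s-), ω(s)) + (1/T) ∫_0^T h(ω(s)) ds`
of a path `ω`. -/
def observable (g : E × E →ᵇ ℝ) (h : E →ᵇ ℝ) (T : ℝ) (ω : ℝ → E) : ℝ :=
  1 / T * (∑ᶠ s ∈ {s : ℝ | 0 < s ∧ s ≤ T ∧ Function.leftLim ω s ≠ ω s},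
      g (Function.leftLim ω s, ω s))
    + 1 / T * ∫ s in (0 : ℝ)..T, h (ω s)

end PathFunctionals

variable {E : Type*} [TopologicalSpace E] [MeasurableSpace E]

namespace JumpRates

variable (M : JumpRates E)

/-- The transition rate measure `W(x, dy)`. -/
def W (x : E) : Measure E := ENNReal.ofReal (M.rate x) • M.jump x

/-! ### Construction of the process

The process is built from its jump chain `Y` and independent standard exponential clocks `e`: the
canonical sample space consists of the sequences `z n = (Y n, e n)`, and the process stays in `Y n`
for the time `e n / rate (Y n)` before it moves to `Y (n + 1)`. -/

/-- One step of the chain `(Y n, e n)`: given the past, `Y (n + 1)` has law `jump (Y n)` and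
`e (n + 1)` is an independent standard exponential variable. -/
def stepKernel : Kernel (E × ℝ) (E × ℝ) :=
  (M.jump ×ₖ Kernel.const E (expMeasure 1)).comap Prod.fst measurable_fst

/-- `stepKernel` as a kernel from the history up to time `n`. -/
def historyKernel (n : ℕ) : Kernel (Π _ : Finset.Iic n, E × ℝ) (E × ℝ) :=
  M.stepKernel.comap (fun z => z ⟨n, Finset.mem_Iic.2 le_rfl⟩) (measurable_pi_apply _)

instance isMarkovKernel_historyKernel (n : ℕ) : IsMarkovKernel (M.historyKernel n) := by
  have := M.isMarkov
  unfold historyKernel stepKernel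
  infer_instance

/-- The law of `(Y 0, e 0)` for the process started in `x`. -/
def initialKernel (E : Type*) [MeasurableSpace E] : Kernel E (Π _ : Finset.Iic 0, E × ℝ) :=
  (Kernel.id ×ₖ Kernel.const E (expMeasure 1)).map fun z _ => z

/-- `M.pathLaw x` is the law `ℙ_x` of `(Y n, e n)`, `n ≥ 0`, for the process started in `x`. -/
def pathLaw : Kernel E (ℕ → E × ℝ) :=
  Kernel.traj (X := fun _ => E × ℝ) M.historyKernel 0 ∘ₖ initialKernel E

/-- `M.lawFrom μ₀` is the law `ℙ_{μ₀}` for the process with initial distribution `μ₀`. -/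
def lawFrom (μ₀ : Measure E) : Measure (ℕ → E × ℝ) := μ₀.bind M.pathLaw

/-- The time of the `n`-th jump (and `jumpTime 0 = 0`). -/
def jumpTime (z : ℕ → E × ℝ) (n : ℕ) : ℝ := ∑ i ∈ Finset.range n, (z i).2 / M.rate (z i).1

/-- The number of jumps up to time `t`, almost surely finite as the rates are bounded. -/
def jumpCount (z : ℕ → E × ℝ) (t : ℝ) : ℕ := sSup {n : ℕ | M.jumpTime z n ≤ t}

/-- The path `t ↦ X_t` of the jump process; it is only used at times `t ≥ 0`. -/
def path (z : ℕ → E × ℝ) (t : ℝ) : E := (z (M.jumpCount z t)).1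

/-- The weight `e^{k t A_t}`. -/
def weight (g : E × E →ᵇ ℝ) (h : E →ᵇ ℝ) (k t : ℝ) (z : ℕ → E × ℝ) : ℝ :=
  Real.exp (k * t * observable g h t (M.path z))

/-- The tilted semigroup `P_k(t) f (x) = 𝔼_x[f(X_t) e^{k t A_t}]`. -/
def tiltedSemigroup (g : E × E →ᵇ ℝ) (h : E →ᵇ ℝ) (k t : ℝ) (f : E → ℝ) (x : E) : ℝ :=
  ∫ z, f (M.path z t) * M.weight g h k t z ∂(M.pathLaw x)

/-- The unnormalised Feynman-Kac measure `ν_t(f) = μ₀(P_k(t) f)`. -/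
def nu (g : E × E →ᵇ ℝ) (h : E →ᵇ ℝ) (k : ℝ) (μ₀ : Measure E) (t : ℝ) (f : E → ℝ) : ℝ :=
  ∫ x, M.tiltedSemigroup g h k t f x ∂μ₀

/-- The normalised Feynman-Kac measure `μ_t(f) = ν_t(f) / ν_t(1)`. -/
def mu (g : E × E →ᵇ ℝ) (h : E →ᵇ ℝ) (k : ℝ) (μ₀ : Measure E) (t : ℝ) (f : E → ℝ) : ℝ :=
  M.nu g h k μ₀ t f / M.nu g h k μ₀ t (fun _ => 1)

/-- The modified escape rate `∫ W(x, dy) e^{k g(x, y)}`. -/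
def tiltedRate (g : E × E →ᵇ ℝ) (k : ℝ) (x : E) : ℝ := ∫ y, Real.exp (k * g (x, y)) ∂(M.W x)

/-- The potential `V_k(x) = ∫ W(x, dy) e^{k g(x, y)} - rate x + k h(x)`. -/
def potential (g : E × E →ᵇ ℝ) (h : E →ᵇ ℝ) (k : ℝ) (x : E) : ℝ :=
  M.tiltedRate g k x - M.rate x + k * h x

/-- `Λ` is the scaled cumulant generating function at `k`:
`(1/T) log 𝔼_{μ₀}[e^{k T A_T}] → Λ` as `T → ∞`. -/
def IsSCGF (g : E × E →ᵇ ℝ) (h : E →ᵇ ℝ) (k : ℝ) (μ₀ : Measure E) (Λ : ℝ) : Prop :=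
  Tendsto (fun T : ℝ => 1 / T * Real.log (∫ z, M.weight g h k T z ∂(M.lawFrom μ₀)))
    atTop (𝓝 Λ)

/-- Asymptotic stability of the tilted semigroup with growth rate `Λ`: there are a positive
`r ∈ C_b(E)`, a probability measure `μinf` and constants `α > 0`, `ρ ∈ (0, 1)` with
`‖e^{-tΛ} P_k(t) f - μinf(f) r‖ ≤ ‖f‖ α ρ^t` for all `t ≥ 0` and `f ∈ C_b(E)`.
The function `r` is then the eigenfunction of the generator for the principal eigenvalue `Λ`,
with `μinf(r) = 1`; the choice `r = 1` is allowed. -/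
def AsymptoticallyStable (g : E × E →ᵇ ℝ) (h : E →ᵇ ℝ) (k Λ : ℝ) : Prop :=
  ∃ (r : E →ᵇ ℝ) (μinf : Measure E) (α ρ : ℝ), (∀ x, 0 < r x) ∧ IsProbabilityMeasure μinf ∧
    0 < α ∧ 0 < ρ ∧ ρ < 1 ∧
    ∀ t : ℝ, 0 ≤ t → ∀ (f : E →ᵇ ℝ) (x : E),
      |Real.exp (-(t * Λ)) * M.tiltedSemigroup g h k t f x - (∫ y, f y ∂μinf) * r x|
        ≤ ‖f‖ * (α * ρ ^ t)

end JumpRates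

end TiltedJump

end

/-! The potential is the image of the constant function 1 under the generator `L_k = tiltedJump +
holdingRate` of the tilted semigroup (`potential_eq`). Hence `ν_t(1)` has time derivative
`ν_t(V_k)`; dividing by `ν_t(1) > 0` makes `μ_t(V_k)` the derivative of `log ν_t(1)`, and
integration from `ν_0(1) = 1` gives (1). For (2), asymptotic stability with `f = 1`, integrated
against `μ₀`, shows that `e^{-TΛ} ν_T(1)` converges to `μ₀(r) > 0`. The logarithm of this quantity,
divided by `T`, therefore vanishes, and `Λ` is the limit of `(1/T) log ν_T(1)`; (1) rewrites this as
a time average.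

The work lies in proving `∂ₜ P_k(t) 1 = P_k(t) V_k` for the process built from jump chain and
clocks. The only Markov property needed is the one at the first jump (`pathLaw_eq_map_prepend`).
Together with the additivity of `t A_t` it yields a renewal equation (`tiltedMean_renewal`), then a
variation of constants formula (`flow_eq_duhamel`) and the backward equation `∂ₜ P_k(t) f = L_k
P_k(t) f` (`flow_eq_add_integral`) for bounded measurable `f`. The forward equation for `f = 1`
follows by uniqueness (`flow_one_eq`): both sides, integrated in time, solve the same linear
equation, and `L_k` is bounded. Finite exponential moments, uniform in the starting point, come from
a Chernoff bound on the number of jumps (`lintegral_exp_jumpSum_le`). -/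

noncomputable section

namespace TiltedJump

/-! ### The Markov property at the first jump -/

/-- The sequence `s, z 0, z 1, …`. -/
def prepend {S : Type*} (s : S) (z : ℕ → S) : ℕ → S
  | 0 => s
  | n + 1 => z n

@[simp] lemma prepend_zero {S : Type*} (s : S) (z : ℕ → S) : prepend s z 0 = s := rfl

@[simp] lemma prepend_succ {S : Type*} (s : S) (z : ℕ → S) (n : ℕ) :
    prepend s z (n + 1) = z n := rfl

lemma measurable_prepend {S : Type*} [MeasurableSpace S] :
    Measurable fun p : S × (ℕ → S) => prepend p.1 p.2 := by
  refine measurable_pi_iff.2 fun n => ?_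
  cases n with
  | zero => exact measurable_fst
  | succ n => exact (measurable_pi_apply n).comp measurable_snd

/-- Two probability measures on sequences agree if they give the same expectation to all finite
products of nonnegative functions of the coordinates. -/
lemma measure_seq_ext {S : Type*} [MeasurableSpace S] {P Q : Measure (ℕ → S)}
    [IsProbabilityMeasure P] [IsProbabilityMeasure Q]
    (hPQ : ∀ (φ : ℕ → S → ENNReal), (∀ n, Measurable (φ n)) → ∀ n,
      ∫⁻ z, ∏ i ∈ Finset.range n, φ i (z i) ∂P = ∫⁻ z, ∏ i ∈ Finset.range n, φ i (z i) ∂Q) :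
    P = Q := by
  refine ext_of_generate_finite _ (generateFrom_squareCylinders (α := fun _ : ℕ => S)).symm
    (isPiSystem_squareCylinders (fun _ => MeasurableSpace.isPiSystem_measurableSet)
      fun _ => MeasurableSet.univ) ?_ (by simp)
  rintro _ ⟨s, t, ht, rfl⟩
  have ht' : ∀ i, MeasurableSet (t i) := fun i => ht i (Set.mem_univ i)
  obtain ⟨n, hn⟩ := s.exists_nat_subset_range
  classical
  -- Indicators on `s` and the constant 1 elsewhere turn the product into the indicator of the
  -- square cylinder.
  let φ : ℕ → S → ENNReal := fun i => if i ∈ s then (t i).indicator 1 else 1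
  have hφ : ∀ i, Measurable (φ i) := fun i => by
    by_cases h : i ∈ s
    · simpa [φ, h] using measurable_one.indicator (ht' i)
    · simpa [φ, h] using measurable_one
  have hprod : ∀ z : ℕ → S, ∏ i ∈ Finset.range n, φ i (z i) =
      ((s : Set ℕ).pi t).indicator 1 z := fun z => by
    by_cases hz : z ∈ (s : Set ℕ).pi t
    · rw [Set.indicator_of_mem hz]
      refine Finset.prod_eq_one fun i _ => ?_
      by_cases h : i ∈ s
      · simp [φ, h, hz i h]
      · simp [φ, h]
    · rw [Set.indicator_of_notMem hz]
      simp only [Set.mem_pi, not_forall] at hz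
      obtain ⟨i, hi, hzi⟩ := hz
      refine Finset.prod_eq_zero (hn hi) ?_
      have hi' : i ∈ s := hi
      simp [φ, hi', hzi]
  have hm : MeasurableSet ((s : Set ℕ).pi t) :=
    MeasurableSet.pi s.countable_toSet fun i _ => ht' i
  have := hPQ φ hφ n
  simpa only [hprod, lintegral_indicator_one hm] using this

lemma measurable_prod_eval {S : Type*} [MeasurableSpace S] {φ : ℕ → S → ENNReal}
    (hφ : ∀ n, Measurable (φ n)) (n : ℕ) :
    Measurable fun z : ℕ → S => ∏ i ∈ Finset.range n, φ i (z i) :=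
  Finset.measurable_prod _ fun i _ => (hφ i).comp (measurable_pi_apply i)

variable {E : Type*} [TopologicalSpace E] [MeasurableSpace E]

namespace JumpRates

variable (M : JumpRates E)

instance : IsMarkovKernel M.jump := M.isMarkov

instance isMarkovKernel_stepKernel : IsMarkovKernel M.stepKernel := by
  unfold stepKernel
  infer_instance

lemma stepKernel_apply (s : E × ℝ) :
    M.stepKernel s = (M.jump s.1).prod (expMeasure 1) := by
  rw [stepKernel, Kernel.comap_apply, Kernel.prod_apply, Kernel.const_apply]

instance isMarkovKernel_initialKernel : IsMarkovKernel (initialKernel E) := by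
  unfold initialKernel
  exact Kernel.IsMarkovKernel.map _ (by fun_prop)

instance isMarkovKernel_pathLaw : IsMarkovKernel M.pathLaw := by
  unfold pathLaw
  infer_instance

lemma pathLaw_eq_trajMeasure (x : E) : M.pathLaw x =
    Kernel.trajMeasure (X := fun _ => E × ℝ) ((Measure.dirac x).prod (expMeasure 1))
      M.historyKernel := by
  rw [pathLaw, Kernel.comp_apply, Kernel.trajMeasure, initialKernel,
    Kernel.map_apply _ (by fun_prop), Kernel.prod_apply, Kernel.id_apply, Kernel.const_apply]
  rfl

/-- The backward iteration `ψ ↦ φ₀ · K (φ₁ · K (⋯ K ψ))` computing the expectation of products. -/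
def backward (φ : ℕ → E × ℝ → ENNReal) : ℕ → (E × ℝ → ENNReal) → E × ℝ → ENNReal
  | 0, ψ => ψ
  | n + 1, ψ => backward φ n fun s => φ n s * ∫⁻ s', ψ s' ∂(M.stepKernel s)

/-- The definition peels off the last factor, as suits the extension of histories; a decomposition
at the first jump needs the first factor peeled off instead. -/
lemma backward_succ (φ : ℕ → E × ℝ → ENNReal) (n : ℕ) (ψ : E × ℝ → ENNReal) (s : E × ℝ) :
    M.backward φ (n + 1) ψ s =
      φ 0 s * ∫⁻ s', M.backward (fun i => φ (i + 1)) n ψ s' ∂(M.stepKernel s) := by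
  induction n generalizing ψ with
  | zero => rfl
  | succ n ih => rw [backward, ih, backward]

/-- Given the history up to time `n`, coordinate `n + 1` has law `historyKernel n`. Integrating it
out turns `ψ` into a function of coordinate `n`, and induction applies. -/
lemma lintegral_trajMeasure_prod_mul (m : Measure (E × ℝ)) [IsProbabilityMeasure m]
    {φ : ℕ → E × ℝ → ENNReal} (hφ : ∀ n, Measurable (φ n)) (n : ℕ) {ψ : E × ℝ → ENNReal}
    (hψ : Measurable ψ) :
    ∫⁻ z, (∏ i ∈ Finset.range n, φ i (z i)) * ψ (z n)
        ∂(Kernel.trajMeasure (X := fun _ => E × ℝ) m M.historyKernel) =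
      ∫⁻ s, M.backward φ n ψ s ∂m := by
  induction n generalizing ψ with
  | zero =>
    simp only [Finset.range_zero, Finset.prod_empty, one_mul, backward]
    have h := Kernel.traj_map_frestrictLe (X := fun _ => E × ℝ) (κ := M.historyKernel) 0 0
    rw [Kernel.partialTraj_self] at h
    have h0 : (Kernel.trajMeasure (X := fun _ => E × ℝ) m M.historyKernel).map (fun z => z 0)
        = m := by
      have : (fun z : ℕ → E × ℝ => z 0) =
          (MeasurableEquiv.piUnique (fun _ : Finset.Iic 0 => E × ℝ)) ∘
            Preorder.frestrictLe (π := fun _ => E × ℝ) 0 := rfl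
      rw [this, ← Measure.map_map (by fun_prop) (by fun_prop), Kernel.trajMeasure,
        Measure.map_comp _ _ (by fun_prop), h, Measure.id_comp]
      exact MeasurableEquiv.map_map_symm _
    conv_rhs => rw [← h0]
    rw [lintegral_map hψ (by fun_prop)]
  | succ n ih =>
    rw [backward, ← ih (ψ := fun s => φ n s * ∫⁻ s', ψ s' ∂(M.stepKernel s))
      ((hφ n).mul hψ.lintegral_kernel)]
    have h := Kernel.map_frestrictLe_trajMeasure_compProd_eq_map_trajMeasure
      (X := fun _ => E × ℝ) (μ₀ := m) (κ := M.historyKernel) (a := n)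
    -- The product over `i ≤ n` as a function of the history alone, so that the disintegration `h`
    -- applies.
    let Φ : (Π _ : Finset.Iic n, E × ℝ) → ENNReal :=
      fun y => ∏ i ∈ (Finset.range (n + 1)).attach,
        φ i.1 (y ⟨i.1, Finset.mem_Iic.2 (Finset.mem_range_succ_iff.1 i.2)⟩)
    have hΦ : Measurable Φ := by
      refine Finset.measurable_prod _ fun i _ => (hφ _).comp (measurable_pi_apply _)
    have hΦ' : ∀ z : ℕ → E × ℝ, Φ (Preorder.frestrictLe (π := fun _ => E × ℝ) n z) =
        ∏ i ∈ Finset.range (n + 1), φ i (z i) := fun z =>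
      Finset.prod_attach (Finset.range (n + 1)) fun i => φ i (z i)
    have hlhs := lintegral_map (μ := Kernel.trajMeasure (X := fun _ => E × ℝ) m M.historyKernel)
      (f := fun p : (Π _ : Finset.Iic n, E × ℝ) × (E × ℝ) => Φ p.1 * ψ p.2)
      (g := fun z => (Preorder.frestrictLe (π := fun _ => E × ℝ) n z, z (n + 1)))
      (by fun_prop) (by fun_prop)
    simp only [hΦ'] at hlhs
    rw [← hlhs, ← h, Measure.lintegral_compProd (by fun_prop),
      lintegral_congr fun y => lintegral_const_mul (Φ y) hψ,
      lintegral_map (f := fun y => Φ y * ∫⁻ s', ψ s' ∂(M.historyKernel n y))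
        (hΦ.mul hψ.lintegral_kernel) (by fun_prop)]
    refine lintegral_congr fun z => ?_
    rw [hΦ', Finset.prod_range_succ, mul_assoc]
    rfl

lemma lintegral_pathLaw_prod_mul (x : E) {φ : ℕ → E × ℝ → ENNReal} (hφ : ∀ n, Measurable (φ n))
    (n : ℕ) {ψ : E × ℝ → ENNReal} (hψ : Measurable ψ) :
    ∫⁻ z, (∏ i ∈ Finset.range n, φ i (z i)) * ψ (z n) ∂(M.pathLaw x) =
      ∫⁻ s, M.backward φ n ψ s ∂((Measure.dirac x).prod (expMeasure 1)) := by
  rw [pathLaw_eq_trajMeasure, lintegral_trajMeasure_prod_mul _ _ hφ _ hψ]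

lemma measurable_backward {φ : ℕ → E × ℝ → ENNReal} (hφ : ∀ n, Measurable (φ n)) (n : ℕ)
    {ψ : E × ℝ → ENNReal} (hψ : Measurable ψ) : Measurable (M.backward φ n ψ) := by
  induction n generalizing ψ with
  | zero => exact hψ
  | succ n ih => exact ih ((hφ n).mul hψ.lintegral_kernel)

/-- The Markov property at the first jump: the process starts with an exponential clock, followed
by an independent copy of the process started from the position after the first jump. -/
lemma pathLaw_eq_map_prepend (x : E) :
    M.pathLaw x = ((expMeasure 1).prod (M.pathLaw ∘ₘ M.jump x)).map
      fun p => prepend (x, p.1) p.2 := by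
  have hm : Measurable fun p : ℝ × (ℕ → E × ℝ) => prepend (x, p.1) p.2 :=
    measurable_prepend.comp ((measurable_const.prodMk measurable_fst).prodMk measurable_snd)
  have : IsProbabilityMeasure (((expMeasure 1).prod (M.pathLaw ∘ₘ M.jump x)).map
      fun p => prepend (x, p.1) p.2) := Measure.isProbabilityMeasure_map hm.aemeasurable
  refine measure_seq_ext fun φ hφ n => ?_
  cases n with
  | zero => simp
  | succ n =>
    -- A single factor involves no transition of the chain and is treated apart; from two factors
    -- on, `backward_succ` exposes the first transition.
    cases n with
    | zero =>
      have h := M.lintegral_pathLaw_prod_mul x hφ 0 (hφ 0)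
      simp only [Finset.range_zero, Finset.prod_empty, one_mul, backward] at h
      rw [lintegral_map (by fun_prop) hm]
      simp only [zero_add, Finset.range_one, Finset.prod_singleton, prepend_zero]
      rw [h, lintegral_prod _ (by fun_prop), lintegral_dirac' _
        (Measurable.lintegral_prod_right' (by fun_prop)), lintegral_prod _ (by fun_prop)]
      simp
    | succ n =>
      have h := M.lintegral_pathLaw_prod_mul x hφ (n + 1) (hφ (n + 1))
      simp only [← Finset.prod_range_succ] at h
      have hb := M.measurable_backward (fun i => hφ (i + 1)) n (hφ (n + 1))
      have hm' := (measurable_prod_eval hφ (n + 1 + 1)).comp hm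
      simp only [Function.comp_def] at hm'
      rw [h, lintegral_map (by fun_prop) hm, lintegral_prod _
        (M.measurable_backward hφ _ (hφ _)).aemeasurable, lintegral_dirac' _
        (Measurable.lintegral_prod_right' (M.measurable_backward hφ _ (hφ _))),
        lintegral_prod _ hm'.aemeasurable]
      refine lintegral_congr fun e => ?_
      simp only [backward_succ, stepKernel_apply, Finset.prod_range_succ' _ (n + 1), prepend_succ,
        prepend_zero]
      have hp := measurable_prod_eval (fun i => hφ (i + 1)) (n + 1)
      rw [lintegral_mul_const _ hp, mul_comm]
      congr 1
      rw [Measure.lintegral_bind M.pathLaw.measurable.aemeasurable hp.aemeasurable,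
        lintegral_prod _ hb.aemeasurable]
      refine lintegral_congr fun y => ?_
      have h' := M.lintegral_pathLaw_prod_mul y (fun i => hφ (i + 1)) n (hφ (n + 1))
      simp only [← Finset.prod_range_succ (fun i => φ (i + 1) _)] at h'
      rw [h', lintegral_prod _ hb.aemeasurable, lintegral_dirac' _
        (Measurable.lintegral_prod_right' hb)]

end JumpRates

/-! ### Paths as step functions, and `t A_t` as a finite sum -/

/-- The endpoint `b` is a null set; it is left out because paths jump there. -/
lemma intervalIntegral_of_eq_const {f : ℝ → ℝ} {a b c : ℝ} (hab : a ≤ b)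
    (hf : ∀ s, a ≤ s → s < b → f s = c) :
    IntervalIntegrable f volume a b ∧ ∫ s in a..b, f s = c * (b - a) := by
  have hae : ∀ᵐ s ∂(volume.restrict (Set.uIoc a b)), c = f s := by
    rw [Set.uIoc_of_le hab, ← restrict_Ioo_eq_restrict_Ioc]
    exact ae_restrict_of_forall_mem measurableSet_Ioo fun s hs => (hf s hs.1.le hs.2).symm
  refine ⟨(intervalIntegrable_const (c := c)).congr_ae hae, ?_⟩
  rw [← intervalIntegral.integral_congr_ae_restrict hae, intervalIntegral.integral_const,
    smul_eq_mul, mul_comm]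

variable {E : Type*} [TopologicalSpace E] [MeasurableSpace E]

namespace JumpRates

variable (M : JumpRates E)

/-- All clocks are positive, and the jump times do not accumulate. -/
structure Nonexplosive (z : ℕ → E × ℝ) : Prop where
  clock_pos : ∀ n, 0 < (z n).2
  tendsto_jumpTime : Tendsto (M.jumpTime z) atTop atTop

/-- The value of `t A_t` as a finite sum over the jumps up to time `t`. -/
def jumpSum (g : E × E →ᵇ ℝ) (h : E →ᵇ ℝ) (t : ℝ) (z : ℕ → E × ℝ) : ℝ :=
  ∑ n ∈ Finset.range (M.jumpCount z t),
      (g ((z n).1, (z (n + 1)).1) + h (z n).1 * ((z n).2 / M.rate (z n).1))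
    + h (M.path z t) * (t - M.jumpTime z (M.jumpCount z t))

@[simp] lemma jumpTime_zero (z : ℕ → E × ℝ) : M.jumpTime z 0 = 0 := by simp [jumpTime]

lemma jumpTime_succ (z : ℕ → E × ℝ) (n : ℕ) :
    M.jumpTime z (n + 1) = M.jumpTime z n + (z n).2 / M.rate (z n).1 := by
  simp [jumpTime, Finset.sum_range_succ]

lemma jumpTime_prepend_succ (s : E × ℝ) (z : ℕ → E × ℝ) (n : ℕ) :
    M.jumpTime (prepend s z) (n + 1) = s.2 / M.rate s.1 + M.jumpTime z n := by
  simp [jumpTime, Finset.sum_range_succ', add_comm]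

variable {M} {z : ℕ → E × ℝ}

lemma Nonexplosive.strictMono (hz : M.Nonexplosive z) : StrictMono (M.jumpTime z) :=
  strictMono_nat_of_lt_succ fun n => by
    rw [jumpTime_succ]
    exact lt_add_of_pos_right _ (div_pos (hz.clock_pos n) (M.rate_pos _))

lemma Nonexplosive.prepend (hz : M.Nonexplosive z) {s : E × ℝ} (hs : 0 < s.2) :
    M.Nonexplosive (prepend s z) where
  clock_pos n := by cases n with
    | zero => exact hs
    | succ n => exact hz.clock_pos n
  tendsto_jumpTime := by
    rw [← tendsto_add_atTop_iff_nat 1]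
    simp only [jumpTime_prepend_succ]
    exact tendsto_atTop_add_const_left _ _ hz.tendsto_jumpTime

/-- Strict monotonicity of the jump times gives the set in `jumpCount` the greatest element `n`, so
the default value of `sSup` plays no role. -/
lemma Nonexplosive.jumpCount_eq (hz : M.Nonexplosive z) {n : ℕ} {t : ℝ} (h1 : M.jumpTime z n ≤ t)
    (h2 : t < M.jumpTime z (n + 1)) : M.jumpCount z t = n := by
  refine IsGreatest.csSup_eq ⟨h1, fun m hm => ?_⟩
  have := hz.strictMono.lt_iff_lt.1 (lt_of_le_of_lt hm h2)
  omega

lemma Nonexplosive.exists_le_lt (hz : M.Nonexplosive z) {t : ℝ} (ht : 0 ≤ t) :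
    ∃ n, M.jumpTime z n ≤ t ∧ t < M.jumpTime z (n + 1) := by
  obtain ⟨n, hn⟩ := (hz.tendsto_jumpTime.eventually_gt_atTop t).exists
  classical
  have hex : ∃ n, t < M.jumpTime z n := ⟨n, hn⟩
  obtain ⟨m, hm⟩ : ∃ m, Nat.find hex = m + 1 := by
    refine Nat.exists_eq_succ_of_ne_zero fun h0 => ?_
    have := Nat.find_spec hex
    rw [h0, jumpTime_zero] at this
    exact absurd this (not_lt.2 ht)
  refine ⟨m, not_lt.1 (Nat.find_min hex (by omega)), ?_⟩
  rw [← hm]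
  exact Nat.find_spec hex

/-- Left limits are governed by intervals closed on the right, in contrast to `exists_le_lt`. -/
lemma Nonexplosive.exists_lt_le (hz : M.Nonexplosive z) {t : ℝ} (ht : 0 < t) :
    ∃ n, M.jumpTime z n < t ∧ t ≤ M.jumpTime z (n + 1) := by
  obtain ⟨n, h1, h2⟩ := hz.exists_le_lt ht.le
  rcases h1.lt_or_eq with h | h
  · exact ⟨n, h, h2.le⟩
  · cases n with
    | zero => rw [jumpTime_zero] at h; exact absurd h ht.ne
    | succ m => exact ⟨m, h ▸ hz.strictMono (Nat.lt_succ_self m), h.ge⟩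

lemma Nonexplosive.path_eq (hz : M.Nonexplosive z) {n : ℕ} {t : ℝ} (h1 : M.jumpTime z n ≤ t)
    (h2 : t < M.jumpTime z (n + 1)) : M.path z t = (z n).1 := by
  rw [path, hz.jumpCount_eq h1 h2]

lemma Nonexplosive.leftLim_path [T2Space E] (hz : M.Nonexplosive z) {n : ℕ} {t : ℝ}
    (h1 : M.jumpTime z n < t) (h2 : t ≤ M.jumpTime z (n + 1)) :
    Function.leftLim (M.path z) t = (z n).1 := by
  refine leftLim_eq_of_tendsto (tendsto_const_nhds.congr' ?_)
  filter_upwards [Ioo_mem_nhdsLT h1] with s hs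
  exact (hz.path_eq hs.1.le (hs.2.trans_le h2)).symm

/-- The chain may jump from a state to itself. Such a time is absent from the left-hand index set
but present on the right, where `g` vanishes on the diagonal. -/
lemma Nonexplosive.finsum_jumps [T2Space E] (hz : M.Nonexplosive z) {g : E × E →ᵇ ℝ}
    (hg : ∀ x, g (x, x) = 0) {N : ℕ} {t : ℝ} (h1 : M.jumpTime z N ≤ t)
    (h2 : t < M.jumpTime z (N + 1)) :
    ∑ᶠ s ∈ {s : ℝ | 0 < s ∧ s ≤ t ∧ Function.leftLim (M.path z) s ≠ M.path z s},
      g (Function.leftLim (M.path z) s, M.path z s) =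
    ∑ n ∈ Finset.range N, g ((z n).1, (z (n + 1)).1) := by
  classical
  have hval : ∀ n, g (Function.leftLim (M.path z) (M.jumpTime z (n + 1)),
      M.path z (M.jumpTime z (n + 1))) = g ((z n).1, (z (n + 1)).1) := fun n => by
    rw [hz.leftLim_path (hz.strictMono n.lt_succ_self) le_rfl,
      hz.path_eq le_rfl (hz.strictMono (n + 1).lt_succ_self)]
  rw [finsum_mem_eq_sum_of_inter_support_eq
    (t := (Finset.range N).image fun n => M.jumpTime z (n + 1)), Finset.sum_image]
  · exact Finset.sum_congr rfl fun n _ => hval n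
  · intro a _ b _ hab
    exact Nat.succ_injective (hz.strictMono.injective hab)
  · ext s
    simp only [Set.mem_inter_iff, Function.mem_support, and_congr_left_iff]
    intro hs
    simp only [Finset.coe_image, Set.mem_image, Finset.coe_range, Set.mem_Iio]
    constructor
    · rintro ⟨hs0, hst, -⟩
      obtain ⟨n, hn1, hn2⟩ := hz.exists_lt_le hs0
      rcases hn2.lt_or_eq with h | h
      · rw [hz.leftLim_path hn1 hn2, hz.path_eq hn1.le h] at hs
        exact absurd (hg _) hs
      · refine ⟨n, ?_, h.symm⟩
        have := hz.strictMono.lt_iff_lt.1 ((h ▸ hst).trans_lt h2)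
        omega
    · rintro ⟨n, hn, rfl⟩
      refine ⟨?_, (hz.strictMono.monotone hn).trans h1, fun heq => hs ?_⟩
      · have := hz.strictMono n.succ_pos
        rwa [jumpTime_zero] at this
      · rw [heq]
        exact hg _

lemma Nonexplosive.integral_path (hz : M.Nonexplosive z) (h : E →ᵇ ℝ) (n : ℕ) :
    IntervalIntegrable (fun s => h (M.path z s)) volume 0 (M.jumpTime z n) ∧
    ∫ s in (0 : ℝ)..M.jumpTime z n, h (M.path z s) =
      ∑ i ∈ Finset.range n, h (z i).1 * ((z i).2 / M.rate (z i).1) := by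
  induction n with
  | zero => simp
  | succ n ih =>
    obtain ⟨hi, he⟩ := intervalIntegral_of_eq_const (f := fun s => h (M.path z s))
      (c := h (z n).1) (hz.strictMono n.lt_succ_self).le
      (fun s hs1 hs2 => by rw [hz.path_eq hs1 hs2])
    refine ⟨ih.1.trans hi, ?_⟩
    rw [← intervalIntegral.integral_add_adjacent_intervals ih.1 hi, ih.2, he,
      Finset.sum_range_succ, jumpTime_succ, add_sub_cancel_left]

lemma Nonexplosive.mul_observable [T2Space E] (hz : M.Nonexplosive z) {g : E × E →ᵇ ℝ}
    (hg : ∀ x, g (x, x) = 0) (h : E →ᵇ ℝ) {t : ℝ} (ht : 0 ≤ t) :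
    t * observable g h t (M.path z) = M.jumpSum g h t z := by
  obtain ⟨N, h1, h2⟩ := hz.exists_le_lt ht
  obtain ⟨hi, he⟩ := intervalIntegral_of_eq_const (f := fun s => h (M.path z s))
    (c := h (z N).1) h1 (fun s hs1 hs2 => by rw [hz.path_eq hs1 (hs2.trans h2)])
  have hint := hz.integral_path h N
  -- At `t = 0` the factor `1 / t` cannot be cancelled; there both sides are zero.
  rcases ht.eq_or_lt with rfl | ht
  · have hN : N = 0 := by
      by_contra hN
      have := hz.strictMono (Nat.pos_of_ne_zero hN)
      rw [jumpTime_zero] at this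
      exact absurd h1 (not_le.2 this)
    subst hN
    simp [jumpSum, hz.jumpCount_eq h1 h2]
  · rw [observable, hz.finsum_jumps hg h1 h2,
      ← intervalIntegral.integral_add_adjacent_intervals hint.1 hi, hint.2, he, jumpSum,
      hz.path_eq h1 h2, hz.jumpCount_eq h1 h2, Finset.sum_add_distrib]
    field_simp
    ring

lemma Nonexplosive.weight_eq [T2Space E] (hz : M.Nonexplosive z) {g : E × E →ᵇ ℝ}
    (hg : ∀ x, g (x, x) = 0) (h : E →ᵇ ℝ) (k : ℝ) {t : ℝ} (ht : 0 ≤ t) :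
    M.weight g h k t z = Real.exp (k * M.jumpSum g h t z) := by
  rw [weight, mul_assoc, hz.mul_observable hg h ht]

section Prepend

variable {s : E × ℝ} {t : ℝ}

lemma Nonexplosive.jumpCount_prepend_of_lt (hz : M.Nonexplosive z) (hs : 0 < s.2) (ht : 0 ≤ t)
    (hts : t < s.2 / M.rate s.1) : M.jumpCount (TiltedJump.prepend s z) t = 0 :=
  (hz.prepend hs).jumpCount_eq (by simpa using ht) (by simpa [jumpTime_succ] using hts)

lemma Nonexplosive.jumpCount_prepend_of_le (hz : M.Nonexplosive z) (hs : 0 < s.2)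
    (hts : s.2 / M.rate s.1 ≤ t) : M.jumpCount (TiltedJump.prepend s z) t =
      M.jumpCount z (t - s.2 / M.rate s.1) + 1 := by
  obtain ⟨n, h1, h2⟩ := hz.exists_le_lt (sub_nonneg.2 hts)
  rw [hz.jumpCount_eq h1 h2]
  apply (hz.prepend hs).jumpCount_eq <;> rw [jumpTime_prepend_succ] <;> linarith

lemma Nonexplosive.path_prepend_of_lt (hz : M.Nonexplosive z) (hs : 0 < s.2) (ht : 0 ≤ t)
    (hts : t < s.2 / M.rate s.1) : M.path (TiltedJump.prepend s z) t = s.1 := by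
  rw [path, hz.jumpCount_prepend_of_lt hs ht hts, prepend_zero]

lemma Nonexplosive.path_prepend_of_le (hz : M.Nonexplosive z) (hs : 0 < s.2)
    (hts : s.2 / M.rate s.1 ≤ t) :
    M.path (TiltedJump.prepend s z) t = M.path z (t - s.2 / M.rate s.1) := by
  rw [path, hz.jumpCount_prepend_of_le hs hts, prepend_succ, path]

lemma Nonexplosive.jumpSum_prepend_of_lt (hz : M.Nonexplosive z) (hs : 0 < s.2) (ht : 0 ≤ t)
    (hts : t < s.2 / M.rate s.1) (g : E × E →ᵇ ℝ) (h : E →ᵇ ℝ) :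
    M.jumpSum g h t (TiltedJump.prepend s z) = h s.1 * t := by
  rw [jumpSum, hz.path_prepend_of_lt hs ht hts, hz.jumpCount_prepend_of_lt hs ht hts]
  simp

/-- Additivity of `t A_t` at the first jump: the holding time and the jump contribute separately
from the shifted path. -/
lemma Nonexplosive.jumpSum_prepend_of_le (hz : M.Nonexplosive z) (hs : 0 < s.2)
    (hts : s.2 / M.rate s.1 ≤ t) (g : E × E →ᵇ ℝ) (h : E →ᵇ ℝ) :
    M.jumpSum g h t (TiltedJump.prepend s z) = g (s.1, (z 0).1) + h s.1 * (s.2 / M.rate s.1) +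
      M.jumpSum g h (t - s.2 / M.rate s.1) z := by
  rw [jumpSum, hz.path_prepend_of_le hs hts, hz.jumpCount_prepend_of_le hs hts,
    Finset.sum_range_succ', jumpTime_prepend_succ, jumpSum]
  simp only [prepend_succ, prepend_zero]
  ring

end Prepend

end JumpRates

/-! ### Exponential clocks, nonexplosion and exponential moments -/

lemma expMeasure_one_eq : expMeasure 1 =
    (volume.restrict (Set.Ioi (0 : ℝ))).withDensity fun x => ENNReal.ofReal (Real.exp (-x)) := by
  have h : expMeasure 1 = volume.withDensity (exponentialPDF 1) := rfl
  rw [h, restrict_Ioi_eq_restrict_Ici, ← withDensity_indicator measurableSet_Ici]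
  congr 1
  ext x
  rw [exponentialPDF_eq]
  by_cases hx : 0 ≤ x
  · simp [hx]
  · simp [hx]

lemma lintegral_expMeasure_one {f : ℝ → ENNReal} (hf : Measurable f) :
    ∫⁻ x, f x ∂(expMeasure 1) =
      ∫⁻ x in Set.Ioi 0, ENNReal.ofReal (Real.exp (-x)) * f x := by
  rw [expMeasure_one_eq, lintegral_withDensity_eq_lintegral_mul _ (by fun_prop) hf]
  rfl

lemma integral_expMeasure_one (f : ℝ → ℝ) :
    ∫ x, f x ∂(expMeasure 1) = ∫ x in Set.Ioi 0, Real.exp (-x) * f x := by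
  rw [expMeasure_one_eq, integral_withDensity_eq_integral_toReal_smul (by fun_prop) (by simp)]
  refine integral_congr_ae (ae_of_all _ fun x => ?_)
  simp [ENNReal.toReal_ofReal (Real.exp_pos _).le]

lemma ae_pos_expMeasure_one : ∀ᵐ x ∂(expMeasure 1), 0 < x := by
  rw [expMeasure_one_eq]
  exact (withDensity_absolutelyContinuous _ _).ae_le (ae_restrict_mem measurableSet_Ioi)

lemma lintegral_exp_neg_mul_expMeasure_one {θ : ℝ} (hθ : 0 ≤ θ) :
    ∫⁻ x, ENNReal.ofReal (Real.exp (-(θ * x))) ∂(expMeasure 1) = ENNReal.ofReal (1 / (1 + θ)) := by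
  rw [lintegral_expMeasure_one (by fun_prop)]
  have h : ∀ x : ℝ, ENNReal.ofReal (Real.exp (-x)) * ENNReal.ofReal (Real.exp (-(θ * x))) =
      ENNReal.ofReal (Real.exp (-(1 + θ) * x)) := fun x => by
    rw [← ENNReal.ofReal_mul (Real.exp_pos _).le, ← Real.exp_add]
    ring_nf
  have hneg : -(1 + θ) < 0 := by linarith
  simp only [h]
  rw [← ofReal_integral_eq_lintegral_ofReal (integrableOn_exp_mul_Ioi hneg 0)
    (ae_of_all _ fun x => (Real.exp_pos _).le), integral_exp_mul_Ioi hneg]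
  congr 1
  simp [div_neg, neg_div, -neg_add_rev]

lemma measurable_prod_exp_clock {E : Type*} [MeasurableSpace E] (θ : ℝ) (n : ℕ) : Measurable fun z : ℕ → E × ℝ =>
    ∏ i ∈ Finset.range n, ENNReal.ofReal (Real.exp (-(θ * (z i).2))) :=
  Finset.measurable_prod _ fun i _ => by fun_prop

variable {E : Type*} [TopologicalSpace E] [MeasurableSpace E]

namespace JumpRates

variable (M : JumpRates E)

lemma lintegral_pathLaw (x : E) {Φ : (ℕ → E × ℝ) → ENNReal} (hΦ : Measurable Φ) :
    ∫⁻ z, Φ z ∂(M.pathLaw x) =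
      ∫⁻ e, ∫⁻ y, ∫⁻ z, Φ (prepend (x, e) z) ∂(M.pathLaw y) ∂(M.jump x) ∂(expMeasure 1) := by
  have hm : Measurable fun p : ℝ × (ℕ → E × ℝ) => prepend (x, p.1) p.2 :=
    measurable_prepend.comp ((measurable_const.prodMk measurable_fst).prodMk measurable_snd)
  rw [pathLaw_eq_map_prepend, lintegral_map hΦ hm,
    lintegral_prod (fun p : ℝ × (ℕ → E × ℝ) => Φ (prepend (x, p.1) p.2))
      (hΦ.comp hm).aemeasurable]
  refine lintegral_congr fun e => ?_
  exact Measure.lintegral_bind M.pathLaw.measurable.aemeasurable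
    (hΦ.comp (hm.comp (measurable_const.prodMk measurable_id))).aemeasurable

/-- First-step analysis for almost sure events, the form used in inductions over the coordinate. -/
lemma ae_pathLaw_of_prepend (x : E) {p : (ℕ → E × ℝ) → Prop} (hp : MeasurableSet {z | p z})
    (h : ∀ᵐ e ∂(expMeasure 1), ∀ y, ∀ᵐ z ∂(M.pathLaw y), p (prepend (x, e) z)) :
    ∀ᵐ z ∂(M.pathLaw x), p z := by
  have hm : Measurable ({z | ¬ p z}.indicator (1 : (ℕ → E × ℝ) → ENNReal)) :=
    measurable_one.indicator hp.compl
  have hc : MeasurableSet {z | ¬ p z} := hp.compl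
  rw [ae_iff, ← lintegral_indicator_one hc]
  refine (M.lintegral_pathLaw x hm).trans ?_
  rw [lintegral_congr_ae (g := 0), lintegral_zero_fun]
  filter_upwards [h] with e he
  rw [lintegral_congr (g := 0), lintegral_zero_fun, Pi.zero_apply]
  intro y
  rw [lintegral_congr_ae (g := 0), lintegral_zero_fun, Pi.zero_apply]
  filter_upwards [he y] with z hz
  simp [hz]

lemma ae_clock_pos (x : E) : ∀ᵐ z ∂(M.pathLaw x), ∀ n, 0 < (z n).2 := by
  rw [ae_all_iff]
  intro n
  have hm : ∀ n, MeasurableSet {z : ℕ → E × ℝ | 0 < (z n).2} := fun n =>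
    measurableSet_lt measurable_const (by fun_prop)
  induction n generalizing x with
  | zero =>
    refine M.ae_pathLaw_of_prepend x (hm 0) ?_
    filter_upwards [ae_pos_expMeasure_one] with e he y
    simpa using he
  | succ n ih =>
    refine M.ae_pathLaw_of_prepend x (hm (n + 1)) (ae_of_all _ fun e y => ?_)
    simpa using ih y

lemma ae_start [MeasurableSingletonClass E] (x : E) : ∀ᵐ z ∂(M.pathLaw x), (z 0).1 = x := by
  have hm : Measurable fun z : ℕ → E × ℝ => (z 0).1 := by fun_prop
  exact M.ae_pathLaw_of_prepend x (hm (measurableSet_singleton x)) (by simp)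

/-- The clocks are independent of the chain, so integrating out the later ones gives a constant free
of the starting point; each clock contributes its Laplace transform. -/
lemma lintegral_prod_exp_clock (x : E) {θ : ℝ} (hθ : 0 ≤ θ) (n : ℕ) :
    ∫⁻ z, ∏ i ∈ Finset.range n, ENNReal.ofReal (Real.exp (-(θ * (z i).2))) ∂(M.pathLaw x) =
      ENNReal.ofReal (1 / (1 + θ)) ^ n := by
  have hm : ∀ n, Measurable fun z : ℕ → E × ℝ =>
      ∏ i ∈ Finset.range n, ENNReal.ofReal (Real.exp (-(θ * (z i).2))) :=
    measurable_prod_exp_clock _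
  induction n generalizing x with
  | zero => simp
  | succ n ih =>
    rw [lintegral_pathLaw _ _ (hm _)]
    simp only [Finset.prod_range_succ' _ n, prepend_succ, prepend_zero]
    simp only [lintegral_mul_const _ (hm n), ih, lintegral_const, measure_univ, mul_one]
    rw [lintegral_const_mul _ (by fun_prop), lintegral_exp_neg_mul_expMeasure_one hθ, pow_succ]

lemma rate_le (x : E) : M.rate x ≤ ‖M.rate‖ := (le_abs_self _).trans (M.rate.norm_coe_le_norm x)

variable {M} in
lemma sum_clock_le {z : ℕ → E × ℝ} (hz : ∀ n, 0 < (z n).2) (n : ℕ) :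
    ∑ i ∈ Finset.range n, (z i).2 ≤ ‖M.rate‖ * M.jumpTime z n := by
  rw [jumpTime, Finset.mul_sum]
  refine Finset.sum_le_sum fun i _ => ?_
  rw [mul_div_assoc', le_div_iff₀ (M.rate_pos _), mul_comm]
  exact mul_le_mul_of_nonneg_right (M.rate_le _) (hz i).le

/-- With `θ = 1` the expected products are `2⁻ⁿ`, hence summable. Almost surely the products tend to
zero, so the clocks have divergent sum, and since the rates are bounded so do the holding times. -/
lemma ae_nonexplosive (x : E) : ∀ᵐ z ∂(M.pathLaw x), M.Nonexplosive z := by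
  have hm : ∀ n, Measurable fun z : ℕ → E × ℝ =>
      ∏ i ∈ Finset.range n, ENNReal.ofReal (Real.exp (-(1 * (z i).2))) :=
    measurable_prod_exp_clock _
  have hfin : ∀ᵐ z ∂(M.pathLaw x),
      ∑' n, ∏ i ∈ Finset.range n, ENNReal.ofReal (Real.exp (-(1 * (z i).2))) < ⊤ := by
    refine ae_lt_top (Measurable.tsum hm) ?_
    rw [lintegral_tsum fun n => (hm n).aemeasurable]
    simp only [M.lintegral_prod_exp_clock x zero_le_one]
    rw [ENNReal.tsum_geometric]
    refine ENNReal.inv_ne_top.2 (tsub_pos_of_lt ?_).ne'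
    rw [ENNReal.ofReal_lt_one]
    norm_num
  filter_upwards [hfin, M.ae_clock_pos x] with z hz hpos
  refine ⟨hpos, ?_⟩
  have h0 := ENNReal.tendsto_atTop_zero_of_tsum_ne_top hz.ne
  have hprod : ∀ n, ∏ i ∈ Finset.range n, ENNReal.ofReal (Real.exp (-(1 * (z i).2))) =
      ENNReal.ofReal (Real.exp (-∑ i ∈ Finset.range n, (z i).2)) := fun n => by
    rw [← ENNReal.ofReal_prod_of_nonneg fun i _ => (Real.exp_pos _).le, ← Real.exp_sum,
      ← Finset.sum_neg_distrib]
    simp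
  simp only [hprod] at h0
  have h1 := (ENNReal.tendsto_toReal ENNReal.zero_ne_top).comp h0
  simp only [Function.comp_def, ENNReal.toReal_ofReal (Real.exp_pos _).le,
    ENNReal.toReal_zero] at h1
  have h2 : Tendsto (fun n => ∑ i ∈ Finset.range n, (z i).2) atTop atTop :=
    tendsto_neg_atBot_iff.1 (Real.tendsto_exp_comp_nhds_zero.1 h1)
  have hC : 0 < ‖M.rate‖ := (M.rate_pos x).trans_le (M.rate_le x)
  exact (tendsto_const_mul_atTop_of_pos hC).1
    (tendsto_atTop_mono (fun n => sum_clock_le hpos n) h2)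

variable {M} in
lemma Nonexplosive.abs_jumpSum_le {z : ℕ → E × ℝ} (hz : M.Nonexplosive z) (g : E × E →ᵇ ℝ)
    (h : E →ᵇ ℝ) {t : ℝ} (ht : 0 ≤ t) :
    |M.jumpSum g h t z| ≤ M.jumpCount z t * ‖g‖ + ‖h‖ * t := by
  obtain ⟨N, h1, h2⟩ := hz.exists_le_lt ht
  rw [jumpSum, hz.jumpCount_eq h1 h2]
  have hA : |∑ n ∈ Finset.range N,
      (g ((z n).1, (z (n + 1)).1) + h (z n).1 * ((z n).2 / M.rate (z n).1))| ≤
      N * ‖g‖ + ‖h‖ * M.jumpTime z N := by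
    refine (Finset.abs_sum_le_sum_abs _ _).trans ?_
    rw [jumpTime, Finset.mul_sum]
    calc _ ≤ ∑ n ∈ Finset.range N, (‖g‖ + ‖h‖ * ((z n).2 / M.rate (z n).1)) := by
          refine Finset.sum_le_sum fun n _ => (abs_add_le _ _).trans ?_
          have hd : 0 ≤ (z n).2 / M.rate (z n).1 :=
            (div_pos (hz.clock_pos n) (M.rate_pos _)).le
          refine add_le_add (g.norm_coe_le_norm _) ?_
          rw [abs_mul, abs_of_nonneg hd]
          exact mul_le_mul_of_nonneg_right (h.norm_coe_le_norm _) hd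
      _ = _ := by simp [Finset.sum_add_distrib]
  have hB : |h (M.path z t) * (t - M.jumpTime z N)| ≤ ‖h‖ * (t - M.jumpTime z N) := by
    rw [abs_mul, abs_of_nonneg (sub_nonneg.2 h1)]
    exact mul_le_mul_of_nonneg_right (h.norm_coe_le_norm _) (sub_nonneg.2 h1)
  refine (abs_add_le _ _).trans ((add_le_add hA hB).trans (le_of_eq ?_))
  ring

/-- An exponential growth rate that bounds the tilted semigroup uniformly in space. -/
def growth (g : E × E →ᵇ ℝ) (h : E →ᵇ ℝ) (k : ℝ) : ℝ :=
  |k| * ‖h‖ + 2 * Real.exp (|k| * ‖g‖) * ‖M.rate‖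

lemma growth_nonneg (g : E × E →ᵇ ℝ) (h : E →ᵇ ℝ) (k : ℝ) : 0 ≤ M.growth g h k := by
  unfold growth
  positivity

/-- Chernoff bound: `N` jumps before `t` force the first `N` clocks to sum to at most `‖rate‖ t`.
The weight `e^{aN}` can thus be paid for by `e^{-θ ∑ clocks}` at the price `e^{θ ‖rate‖ t}`. -/
lemma lintegral_exp_jumpSum_le (g : E × E →ᵇ ℝ) (h : E →ᵇ ℝ) (k : ℝ) {t : ℝ} (ht : 0 ≤ t) (x : E) :
    ∫⁻ z, ENNReal.ofReal (Real.exp (k * M.jumpSum g h t z)) ∂(M.pathLaw x) ≤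
      ENNReal.ofReal (2 * Real.exp (M.growth g h k * t)) := by
  set a := |k| * ‖g‖ with ha
  -- This choice makes the geometric ratio `e^a / (1 + θ)` at most `1/2`; the factor 2 in the bound
  -- is the sum of the series.
  set θ := 2 * Real.exp a with hθ
  have hθ0 : 0 ≤ θ := by positivity
  have hm : ∀ n, Measurable fun z : ℕ → E × ℝ =>
      ∏ i ∈ Finset.range n, ENNReal.ofReal (Real.exp (-(θ * (z i).2))) :=
    measurable_prod_exp_clock _
  have hbound : ∀ᵐ z ∂(M.pathLaw x), ENNReal.ofReal (Real.exp (k * M.jumpSum g h t z)) ≤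
      ENNReal.ofReal (Real.exp (M.growth g h k * t)) * ∑' n, ENNReal.ofReal (Real.exp a) ^ n *
        ∏ i ∈ Finset.range n, ENNReal.ofReal (Real.exp (-(θ * (z i).2))) := by
    filter_upwards [M.ae_nonexplosive x] with z hz
    -- The random number of jumps is removed by bounding its term by the whole series.
    refine le_trans ?_ (mul_le_mul_right (ENNReal.le_tsum (M.jumpCount z t)) _)
    rw [← ENNReal.ofReal_prod_of_nonneg fun i _ => (Real.exp_pos _).le, ← Real.exp_sum,
      ← ENNReal.ofReal_pow (Real.exp_pos _).le, ← Real.exp_nat_mul,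
      ← ENNReal.ofReal_mul (Real.exp_pos _).le, ← ENNReal.ofReal_mul (Real.exp_pos _).le,
      ← Real.exp_add, ← Real.exp_add]
    refine ENNReal.ofReal_le_ofReal (Real.exp_le_exp.2 ?_)
    obtain ⟨N, h1, h2⟩ := hz.exists_le_lt ht
    have h3 := hz.abs_jumpSum_le g h ht
    rw [hz.jumpCount_eq h1 h2] at h3 ⊢
    have h4 := sum_clock_le (M := M) hz.clock_pos N
    have h5 : k * M.jumpSum g h t z ≤ |k| * (N * ‖g‖ + ‖h‖ * t) :=
      (le_abs_self _).trans (by rw [abs_mul]; exact mul_le_mul_of_nonneg_left h3 (abs_nonneg k))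
    have h6 : θ * ∑ i ∈ Finset.range N, (z i).2 ≤ θ * (‖M.rate‖ * t) :=
      mul_le_mul_of_nonneg_left (h4.trans (mul_le_mul_of_nonneg_left h1 (norm_nonneg _))) hθ0
    rw [Finset.sum_neg_distrib, ← Finset.mul_sum, growth, ← ha, ← hθ]
    calc _ ≤ _ := h5
      _ = N * a + |k| * ‖h‖ * t := by rw [ha]; ring
      _ ≤ _ := by linarith
  refine (lintegral_mono_ae hbound).trans ?_
  rw [lintegral_const_mul _ (Measurable.tsum fun n => (hm n).const_mul _),
    lintegral_tsum fun n => ((hm n).const_mul _).aemeasurable]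
  simp only [lintegral_const_mul _ (hm _), M.lintegral_prod_exp_clock x hθ0, ← mul_pow]
  rw [← ENNReal.ofReal_mul (Real.exp_pos _).le]
  have hr : Real.exp a * (1 / (1 + θ)) ≤ 1 / 2 := by
    rw [mul_one_div, div_le_div_iff₀ (by positivity) two_pos, hθ]
    linarith
  calc _ ≤ ENNReal.ofReal (Real.exp (M.growth g h k * t)) * ∑' n : ℕ, (2 : ENNReal)⁻¹ ^ n := by
        gcongr
        refine (ENNReal.ofReal_le_ofReal hr).trans (le_of_eq ?_)
        rw [one_div, ENNReal.ofReal_inv_of_pos two_pos, ENNReal.ofReal_ofNat]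
    _ = _ := by
        rw [ENNReal.tsum_geometric_two, mul_comm 2, ENNReal.ofReal_mul (Real.exp_pos _).le,
          ENNReal.ofReal_ofNat]

end JumpRates

/-! ### The tilted semigroup and its renewal equation -/

lemma integral_bind_kernel {α β : Type*} [MeasurableSpace α] [MeasurableSpace β] {μ : Measure α}
    {κ : Kernel α β} {f : β → ℝ} (hf : Integrable f (κ ∘ₘ μ)) :
    ∫ z, f z ∂(κ ∘ₘ μ) = ∫ x, ∫ z, f z ∂(κ x) ∂μ := by
  rw [Measure.comp_eq_comp_const_apply] at hf ⊢
  rw [Kernel.integral_comp hf, Kernel.const_apply]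

variable {E : Type*} [TopologicalSpace E] [MeasurableSpace E]

namespace JumpRates

variable (M : JumpRates E)

lemma integral_pathLaw (x : E) {Φ : (ℕ → E × ℝ) → ℝ} (hΦ : Integrable Φ (M.pathLaw x)) :
    ∫ z, Φ z ∂(M.pathLaw x) =
      ∫ e, ∫ y, ∫ z, Φ (prepend (x, e) z) ∂(M.pathLaw y) ∂(M.jump x) ∂(expMeasure 1) := by
  have hm : Measurable fun p : ℝ × (ℕ → E × ℝ) => prepend (x, p.1) p.2 :=
    measurable_prepend.comp ((measurable_const.prodMk measurable_fst).prodMk measurable_snd)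
  rw [pathLaw_eq_map_prepend] at hΦ ⊢
  have hi := (integrable_map_measure hΦ.aestronglyMeasurable hm.aemeasurable).1 hΦ
  rw [integral_map hm.aemeasurable hΦ.aestronglyMeasurable,
    integral_prod (fun p : ℝ × (ℕ → E × ℝ) => Φ (prepend (x, p.1) p.2)) hi]
  refine integral_congr_ae ?_
  filter_upwards [hi.prod_right_ae] with e he
  exact integral_bind_kernel he

lemma measurable_rate [OpensMeasurableSpace E] : Measurable M.rate := M.rate.continuous.measurable

variable (g : E × E →ᵇ ℝ) (h : E →ᵇ ℝ) (k : ℝ)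

/-- The random variable `f(X_t) e^{k t A_t}`, with `t A_t` written as a finite sum. -/
def tiltedValue (f : E → ℝ) (t : ℝ) (z : ℕ → E × ℝ) : ℝ :=
  f (M.path z t) * Real.exp (k * M.jumpSum g h t z)

/-- The expectation of `M.tiltedValue g h k f t`; it is the tilted semigroup for `t ≥ 0`. -/
def tiltedMean (f : E → ℝ) (t : ℝ) (x : E) : ℝ :=
  ∫ z, M.tiltedValue g h k f t z ∂(M.pathLaw x)

/-- The operator `f ↦ ∫ W(x, dy) e^{k g(x, y)} f(y)`. -/
def tiltedJump (f : E → ℝ) (x : E) : ℝ := ∫ y, Real.exp (k * g (x, y)) * f y ∂(M.W x)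

variable {g h k}

/-- The exponential rate `k h - rate` of the weight carried by a path that does not jump. -/
def holdingRate (h : E →ᵇ ℝ) (k : ℝ) (x : E) : ℝ := k * h x - M.rate x

lemma ae_weight_eq [T2Space E] (hg : ∀ x, g (x, x) = 0) {t : ℝ} (ht : 0 ≤ t) (x : E) :
    ∀ᵐ z ∂(M.pathLaw x), M.weight g h k t z = Real.exp (k * M.jumpSum g h t z) := by
  filter_upwards [M.ae_nonexplosive x] with z hz using hz.weight_eq hg h k ht

lemma tiltedSemigroup_eq [T2Space E] (hg : ∀ x, g (x, x) = 0) {t : ℝ} (ht : 0 ≤ t)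
    (f : E → ℝ) (x : E) :
    M.tiltedSemigroup g h k t f x = M.tiltedMean g h k f t x := by
  refine integral_congr_ae ?_
  filter_upwards [M.ae_weight_eq (h := h) (k := k) hg ht x] with z hz
  rw [hz, tiltedValue]

lemma integral_W (f : E → ℝ) (x : E) : ∫ y, f y ∂(M.W x) = M.rate x * ∫ y, f y ∂(M.jump x) := by
  rw [W, integral_smul_measure, ENNReal.toReal_ofReal (M.rate_pos x).le, smul_eq_mul]

variable (g k) in
/-- A bound for the norm of the operator `M.tiltedJump g k`. -/
def jumpBound : ℝ := ‖M.rate‖ * Real.exp (|k| * ‖g‖)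

lemma abs_tiltedJump_le {f : E → ℝ} {b : ℝ} (hb : ∀ y, |f y| ≤ b) (x : E) :
    |M.tiltedJump g k f x| ≤ M.jumpBound g k * b := by
  have hpt : ∀ y, ‖Real.exp (k * g (x, y)) * f y‖ ≤ Real.exp (|k| * ‖g‖) * b := fun y => by
    rw [Real.norm_eq_abs, abs_mul, abs_of_pos (Real.exp_pos _)]
    refine mul_le_mul (Real.exp_le_exp.2 ((le_abs_self _).trans ?_)) (hb y) (abs_nonneg _)
      (Real.exp_pos _).le
    rw [abs_mul]
    exact mul_le_mul_of_nonneg_left (g.norm_coe_le_norm _) (abs_nonneg k)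
  have hint := norm_integral_le_of_norm_le_const (μ := M.jump x) (ae_of_all _ hpt)
  rw [probReal_univ, mul_one] at hint
  rw [tiltedJump, integral_W, abs_mul, abs_of_pos (M.rate_pos x), jumpBound, mul_assoc]
  exact mul_le_mul (M.rate_le x) hint (abs_nonneg _) (norm_nonneg _)

lemma measurable_jumpTime [OpensMeasurableSpace E] (n : ℕ) : Measurable fun z : ℕ → E × ℝ => M.jumpTime z n := by
  have := M.measurable_rate
  unfold jumpTime
  fun_prop

lemma measurable_jumpCount [OpensMeasurableSpace E] :
    Measurable fun p : ℝ × (ℕ → E × ℝ) => M.jumpCount p.2 p.1 := by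
  classical
  have heq : ∀ p : ℝ × (ℕ → E × ℝ), M.jumpCount p.2 p.1 =
      ⨆ n, if M.jumpTime p.2 n ≤ p.1 then n else 0 := fun p => by
    rw [jumpCount, iSup]
    by_cases hb : BddAbove {n : ℕ | M.jumpTime p.2 n ≤ p.1}
    · obtain ⟨b, hb'⟩ := id hb
      refine le_antisymm (csSup_le' fun n hn => ?_) (csSup_le' ?_)
      · refine le_csSup ⟨b, ?_⟩ ⟨n, if_pos hn⟩
        rintro _ ⟨m, rfl⟩
        dsimp only
        split_ifs with hm
        · exact hb' hm
        · exact Nat.zero_le _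
      · rintro _ ⟨m, rfl⟩
        dsimp only
        split_ifs with hm
        · exact le_csSup hb hm
        · exact Nat.zero_le _
    -- On exploding sequences both suprema take the default value 0, so the identity holds
    -- everywhere and not only almost surely.
    · rw [Nat.sSup_of_not_bddAbove hb, Nat.sSup_of_not_bddAbove]
      refine fun ⟨b, hb'⟩ => hb ⟨b, fun n hn => hb' ⟨n, if_pos hn⟩⟩
  simp only [heq]
  refine Measurable.iSup fun n => ?_
  exact Measurable.ite (measurableSet_le ((M.measurable_jumpTime n).comp measurable_snd)
    measurable_fst) measurable_const measurable_const

lemma measurable_path [OpensMeasurableSpace E] : Measurable fun p : ℝ × (ℕ → E × ℝ) => M.path p.2 p.1 := by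
  have h : Measurable fun q : ℕ × (ℕ → E × ℝ) => (q.2 q.1).1 :=
    measurable_from_prod_countable_right fun n => by fun_prop
  exact h.comp (M.measurable_jumpCount.prodMk measurable_snd)

variable [PolishSpace E] [BorelSpace E]

lemma measurable_jumpSum (g : E × E →ᵇ ℝ) (h : E →ᵇ ℝ) :
    Measurable fun p : ℝ × (ℕ → E × ℝ) => M.jumpSum g h p.1 p.2 := by
  have hr := M.measurable_rate
  have hg : Measurable g := g.continuous.measurable
  have hh : Measurable h := h.continuous.measurable
  have h1 : Measurable fun q : ℕ × (ℕ → E × ℝ) => ∑ n ∈ Finset.range q.1,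
      (g ((q.2 n).1, (q.2 (n + 1)).1) + h (q.2 n).1 * ((q.2 n).2 / M.rate (q.2 n).1)) :=
    measurable_from_prod_countable_right fun n =>
      Finset.measurable_sum (Finset.range n) fun i _ => by fun_prop
  have h2 : Measurable fun q : ℕ × (ℕ → E × ℝ) => M.jumpTime q.2 q.1 :=
    measurable_from_prod_countable_right fun n => M.measurable_jumpTime n
  have hN := M.measurable_jumpCount.prodMk (measurable_snd (α := ℝ) (β := ℕ → E × ℝ))
  exact (h1.comp hN).add ((hh.comp M.measurable_path).mul (measurable_fst.sub (h2.comp hN)))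

variable {f : E → ℝ}

lemma measurable_tiltedValue (hf : Measurable f) :
    Measurable fun p : ℝ × (ℕ → E × ℝ) => M.tiltedValue g h k f p.1 p.2 :=
  (hf.comp M.measurable_path).mul
    (Real.measurable_exp.comp ((M.measurable_jumpSum g h).const_mul k))

lemma measurable_tiltedMean (hf : Measurable f) :
    Measurable fun p : ℝ × E => M.tiltedMean g h k f p.1 p.2 := by
  have hm : Measurable fun q : (ℝ × E) × (ℕ → E × ℝ) => M.tiltedValue g h k f q.1.1 q.2 :=
    (M.measurable_tiltedValue hf).comp
      ((measurable_fst.comp measurable_fst).prodMk measurable_snd)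
  exact (StronglyMeasurable.integral_kernel_prod_right'
    (κ := M.pathLaw.comap Prod.snd measurable_snd) hm.stronglyMeasurable).measurable

lemma integrable_exp_jumpSum {t : ℝ} (ht : 0 ≤ t) (x : E) :
    Integrable (fun z => Real.exp (k * M.jumpSum g h t z)) (M.pathLaw x) := by
  have hm : Measurable fun z => Real.exp (k * M.jumpSum g h t z) :=
    Real.measurable_exp.comp (((M.measurable_jumpSum g h).comp
      (measurable_const.prodMk measurable_id)).const_mul k)
  refine ⟨hm.aestronglyMeasurable, ?_⟩
  rw [hasFiniteIntegral_iff_ofReal (ae_of_all _ fun z => (Real.exp_pos _).le)]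
  exact (M.lintegral_exp_jumpSum_le g h k ht x).trans_lt ENNReal.ofReal_lt_top

lemma integral_exp_jumpSum_le {t : ℝ} (ht : 0 ≤ t) (x : E) :
    ∫ z, Real.exp (k * M.jumpSum g h t z) ∂(M.pathLaw x) ≤ 2 * Real.exp (M.growth g h k * t) := by
  rw [integral_eq_lintegral_of_nonneg_ae (ae_of_all _ fun z => (Real.exp_pos _).le)
    (M.integrable_exp_jumpSum ht x).aestronglyMeasurable]
  exact ENNReal.toReal_le_of_le_ofReal (by positivity) (M.lintegral_exp_jumpSum_le g h k ht x)

lemma integrable_tiltedValue (hf : Measurable f) {b : ℝ} (hb : ∀ x, |f x| ≤ b) {t : ℝ}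
    (ht : 0 ≤ t) (x : E) : Integrable (M.tiltedValue g h k f t) (M.pathLaw x) := by
  have hm : Measurable (M.tiltedValue g h k f t) :=
    (M.measurable_tiltedValue hf).comp (measurable_const.prodMk measurable_id)
  refine ((M.integrable_exp_jumpSum (g := g) (h := h) (k := k) ht x).const_mul b).mono'
    hm.aestronglyMeasurable (ae_of_all _ fun z => ?_)
  rw [tiltedValue, Real.norm_eq_abs, abs_mul, abs_of_pos (Real.exp_pos _)]
  exact mul_le_mul_of_nonneg_right (hb _) (Real.exp_pos _).le

lemma abs_tiltedMean_le {b : ℝ} (hb : ∀ x, |f x| ≤ b) {t : ℝ}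
    (ht : 0 ≤ t) (x : E) :
    |M.tiltedMean g h k f t x| ≤ b * (2 * Real.exp (M.growth g h k * t)) := by
  have hb0 : 0 ≤ b := (abs_nonneg _).trans (hb x)
  have hpt : ∀ z, ‖M.tiltedValue g h k f t z‖ ≤ b * Real.exp (k * M.jumpSum g h t z) := fun z => by
    rw [tiltedValue, Real.norm_eq_abs, abs_mul, abs_of_pos (Real.exp_pos _)]
    exact mul_le_mul_of_nonneg_right (hb _) (Real.exp_pos _).le
  refine (norm_integral_le_of_norm_le ((M.integrable_exp_jumpSum ht x).const_mul b)
    (ae_of_all _ hpt)).trans ?_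
  rw [integral_const_mul]
  exact mul_le_mul_of_nonneg_left (M.integral_exp_jumpSum_le ht x) hb0

lemma measurable_tiltedJump {F : ℝ × E → ℝ} (hF : Measurable F) :
    Measurable fun p : ℝ × E => M.tiltedJump g k (fun y => F (p.1, y)) p.2 := by
  have hg : Measurable g := g.continuous.measurable
  have hm : Measurable fun q : (ℝ × E) × E => Real.exp (k * g (q.1.2, q.2)) * F (q.1.1, q.2) := by
    fun_prop
  have h1 := (StronglyMeasurable.integral_kernel_prod_right'
    (κ := M.jump.comap Prod.snd measurable_snd) hm.stronglyMeasurable).measurable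
  simp only [tiltedJump, integral_W]
  exact (M.measurable_rate.comp measurable_snd).mul h1

/-- Either the first clock outlasts `t` and the path has not moved, or the process restarts from `y`
with the remaining time. The almost sure start in `y` identifies the argument of `g`. -/
lemma integral_tiltedValue_prepend {t : ℝ} (ht : 0 ≤ t) (x : E) {e : ℝ}
    (he : 0 < e) (y : E) :
    ∫ z, M.tiltedValue g h k f t (prepend (x, e) z) ∂(M.pathLaw y) =
      if t < e / M.rate x then f x * Real.exp (k * (h x * t))
      else Real.exp (k * (h x * (e / M.rate x))) *
        (Real.exp (k * g (x, y)) * M.tiltedMean g h k f (t - e / M.rate x) y) := by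
  split_ifs with hlt
  · rw [integral_congr_ae (g := fun _ => f x * Real.exp (k * (h x * t)))]
    · simp
    filter_upwards [M.ae_nonexplosive y] with z hz
    rw [tiltedValue, hz.path_prepend_of_lt he ht hlt, hz.jumpSum_prepend_of_lt he ht hlt]
  · rw [tiltedMean, ← integral_const_mul, ← integral_const_mul]
    refine integral_congr_ae ?_
    filter_upwards [M.ae_nonexplosive y, M.ae_start y] with z hz hy
    have hle : (x, e).2 / M.rate (x, e).1 ≤ t := not_lt.1 hlt
    rw [tiltedValue, hz.path_prepend_of_le he hle, hz.jumpSum_prepend_of_le he hle, hy,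
      tiltedValue, mul_add, mul_add, Real.exp_add, Real.exp_add]
    ring

/-- The renewal equation: decomposition of the tilted semigroup at the first jump. -/
lemma tiltedMean_renewal (hf : Measurable f) {b : ℝ} (hb : ∀ x, |f x| ≤ b) {t : ℝ} (ht : 0 ≤ t)
    (x : E) :
    M.tiltedMean g h k f t x = f x * Real.exp (M.holdingRate h k x * t) +
      ∫ s in (0 : ℝ)..t, Real.exp (M.holdingRate h k x * s) *
        M.tiltedJump g k (M.tiltedMean g h k f (t - s)) x := by
  set l := M.rate x with hl
  have hl0 : 0 < l := M.rate_pos x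
  let G : ℝ → ℝ := fun r => ∫ y, Real.exp (k * g (x, y)) * M.tiltedMean g h k f r y ∂(M.jump x)
  have hG : ∀ r, M.tiltedJump g k (M.tiltedMean g h k f r) x = l * G r := fun r =>
    M.integral_W _ x
  -- Conditional mean given that the first jump happens at time `s`.
  let ψ : ℝ → ℝ := fun s => if t < s then f x * Real.exp (k * (h x * t))
    else Real.exp (k * (h x * s)) * G (t - s)
  have h1 : M.tiltedMean g h k f t x = ∫ e in Set.Ioi 0, Real.exp (-e) * ψ (e / l) := by
    rw [tiltedMean, M.integral_pathLaw x (M.integrable_tiltedValue hf hb ht x),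
      ← integral_expMeasure_one]
    refine integral_congr_ae ?_
    filter_upwards [ae_pos_expMeasure_one] with e he
    simp only [M.integral_tiltedValue_prepend ht x he, ψ, ← hl]
    split_ifs
    · simp
    · rw [integral_const_mul]
  -- Substitution `e = l s` from the clock to the holding time.
  have h2 : ∫ e in Set.Ioi 0, Real.exp (-e) * ψ (e / l) =
      ∫ s in Set.Ioi 0, l * (Real.exp (-(l * s)) * ψ s) := by
    have := integral_comp_mul_left_Ioi (fun e => Real.exp (-e) * ψ (e / l)) 0 hl0
    rw [mul_zero] at this
    rw [integral_const_mul, ← mul_inv_cancel_left₀ hl0.ne'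
      (∫ e in Set.Ioi 0, Real.exp (-e) * ψ (e / l)), ← smul_eq_mul (a := l⁻¹), ← this]
    simp only [mul_div_cancel_left₀ _ hl0.ne']
  have hlow : Set.EqOn (fun s => l * (Real.exp (-(l * s)) * ψ s))
      (fun s => Real.exp (M.holdingRate h k x * s) *
        M.tiltedJump g k (M.tiltedMean g h k f (t - s)) x) (Set.Ioc 0 t) := fun s hs => by
    simp only [ψ, if_neg (not_lt.2 hs.2), hG, holdingRate, ← hl]
    rw [show (k * h x - l) * s = -(l * s) + k * (h x * s) by ring, Real.exp_add]
    ring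
  -- After `t` only the exponential density depends on `s`; its tail integral supplies the factor
  -- `e^{-l t}` of the no-jump term.
  have hhigh : Set.EqOn (fun s => l * (Real.exp (-(l * s)) * ψ s))
      (fun s => (l * (f x * Real.exp (k * (h x * t)))) * Real.exp (-l * s)) (Set.Ioi t) :=
    fun s hs => by
      have hs' : t < s := hs
      simp only [ψ, if_pos hs']
      ring_nf
  have hJ : Measurable fun s => M.tiltedJump g k (M.tiltedMean g h k f (t - s)) x :=
    (M.measurable_tiltedJump (M.measurable_tiltedMean (g := g) (h := h) (k := k) hf)).comp
      ((measurable_const.sub measurable_id).prodMk measurable_const)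
  have hi1 : IntegrableOn (fun s => Real.exp (M.holdingRate h k x * s) *
        M.tiltedJump g k (M.tiltedMean g h k f (t - s)) x) (Set.Ioc 0 t) := by
    refine IntegrableOn.of_bound measure_Ioc_lt_top (by fun_prop)
      (Real.exp (|M.holdingRate h k x| * t) *
        (M.jumpBound g k * (b * (2 * Real.exp (M.growth g h k * t)))))
      (ae_restrict_of_forall_mem measurableSet_Ioc fun s hs => ?_)
    rw [Real.norm_eq_abs, abs_mul, abs_of_pos (Real.exp_pos _)]
    have hb0 : 0 ≤ b := (abs_nonneg _).trans (hb x)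
    refine mul_le_mul (Real.exp_le_exp.2 ?_) (M.abs_tiltedJump_le (fun y => ?_) x) (abs_nonneg _)
      (Real.exp_pos _).le
    · exact mul_le_mul (le_abs_self _) hs.2 hs.1.le (abs_nonneg _)
    · refine (M.abs_tiltedMean_le hb (sub_nonneg.2 hs.2) y).trans ?_
      have := M.growth_nonneg g h k
      have := hs.1
      gcongr
      linarith
  have hi2 : IntegrableOn (fun s => (l * (f x * Real.exp (k * (h x * t)))) * Real.exp (-l * s))
      (Set.Ioi t) := (integrableOn_exp_mul_Ioi (neg_neg_of_pos hl0) t).const_mul _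
  rw [h1, h2, ← Set.Ioc_union_Ioi_eq_Ioi ht, setIntegral_union (Set.Ioc_disjoint_Ioi le_rfl)
    measurableSet_Ioi (hi1.congr_fun hlow.symm measurableSet_Ioc)
    (hi2.congr_fun hhigh.symm measurableSet_Ioi), setIntegral_congr_fun measurableSet_Ioc hlow,
    setIntegral_congr_fun measurableSet_Ioi hhigh, integral_const_mul,
    integral_exp_mul_Ioi (neg_neg_of_pos hl0), intervalIntegral.integral_of_le ht, add_comm]
  congr 1
  rw [holdingRate, ← hl, show (k * h x - l) * t = k * (h x * t) + -l * t by ring, Real.exp_add]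
  field_simp

end JumpRates

/-! ### Families regular in time: dominated convergence and Fubini -/

/-- Families `U t x` that are continuous in time, measurable in space, and bounded uniformly in
space and locally uniformly in time. -/
structure TimeRegular {E : Type*} [MeasurableSpace E] (U : ℝ → E → ℝ) : Prop where
  measurable : ∀ t, Measurable (U t)
  continuous : ∀ x, Continuous fun t => U t x
  bounded : ∀ T, ∃ C, ∀ t, |t| ≤ T → ∀ x, |U t x| ≤ C

lemma intervalIntegrable_of_bounded {w : ℝ → ℝ} (hw : Measurable w)
    (hb : ∀ T, ∃ C, ∀ t, |t| ≤ T → |w t| ≤ C) (a b : ℝ) : IntervalIntegrable w volume a b := by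
  obtain ⟨C, hC⟩ := hb (max |a| |b|)
  rw [intervalIntegrable_iff]
  refine IntegrableOn.of_bound measure_Ioc_lt_top hw.aestronglyMeasurable C
    (ae_restrict_of_forall_mem measurableSet_uIoc fun t ht => hC t ?_)
  have h1 := Set.uIoc_subset_uIcc ht
  rw [Set.mem_uIcc] at h1
  rw [abs_le]
  have ha := neg_abs_le a
  have hb := neg_abs_le b
  have ha' := le_abs_self a
  have hb' := le_abs_self b
  have h2 := le_max_left |a| |b|
  have h3 := le_max_right |a| |b|
  rcases h1 with h1 | h1 <;> constructor <;> linarith [h1.1, h1.2]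

namespace TimeRegular

variable {E : Type*} [MeasurableSpace E] {U V : ℝ → E → ℝ}

lemma measurable_uncurry (hU : TimeRegular U) : Measurable fun p : ℝ × E => U p.1 p.2 :=
  measurable_uncurry_of_continuous_of_measurable hU.continuous hU.measurable

lemma integrable (hU : TimeRegular U) (t : ℝ) (μ : Measure E) [IsFiniteMeasure μ] :
    Integrable (U t) μ := by
  obtain ⟨C, hC⟩ := hU.bounded |t|
  exact Integrable.of_bound (hU.measurable t).aestronglyMeasurable C
    (ae_of_all _ fun x => hC t le_rfl x)

lemma continuous_integral (hU : TimeRegular U) (μ : Measure E) [IsFiniteMeasure μ] :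
    Continuous fun t => ∫ x, U t x ∂μ := by
  rw [continuous_iff_continuousAt]
  intro t
  obtain ⟨C, hC⟩ := hU.bounded (|t| + 1)
  refine continuousAt_of_dominated (bound := fun _ => C)
    (Eventually.of_forall fun s => (hU.measurable s).aestronglyMeasurable) ?_
    (integrable_const C) (ae_of_all _ fun x => (hU.continuous x).continuousAt)
  filter_upwards [(continuous_abs.tendsto t).eventually_lt_const (lt_add_one |t|)] with s hs
  exact ae_of_all _ fun x => hC s hs.le x

lemma integral_intervalIntegral (hU : TimeRegular U) (μ : Measure E) [IsFiniteMeasure μ] (t : ℝ) :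
    ∫ x, (∫ s in (0 : ℝ)..t, U s x) ∂μ = ∫ s in (0 : ℝ)..t, ∫ x, U s x ∂μ := by
  obtain ⟨C, hC⟩ := hU.bounded |t|
  refine (intervalIntegral_integral_swap ?_).symm
  have : IsFiniteMeasure ((volume : Measure ℝ).restrict (Set.uIoc 0 t)) :=
    isFiniteMeasure_restrict.2 measure_Ioc_lt_top.ne
  refine Integrable.of_bound hU.measurable_uncurry.aestronglyMeasurable C ?_
  have hset : MeasurableSet (Set.uIoc 0 t) := measurableSet_uIoc
  have h := Measure.ae_prod_mem_iff_ae_ae_mem (μ := volume.restrict (Set.uIoc 0 t)) (ν := μ)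
    (measurableSet_uIoc.prod MeasurableSet.univ : MeasurableSet (Set.uIoc 0 t ×ˢ Set.univ))
  have h' := h.2 ((ae_restrict_mem hset).mono fun s hs => ae_of_all _ fun x => ⟨hs, trivial⟩)
  filter_upwards [h'] with p hp
  refine hC p.1 ?_ p.2
  have h1 := Set.uIoc_subset_uIcc hp.1
  simpa using Set.abs_sub_left_of_mem_uIcc h1

lemma mul_left {φ : E → ℝ} (hφ : Measurable φ) {C : ℝ} (hC : ∀ x, |φ x| ≤ C)
    (hU : TimeRegular U) : TimeRegular fun t x => φ x * U t x where
  measurable t := hφ.mul (hU.measurable t)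
  continuous x := (hU.continuous x).const_mul _
  bounded T := by
    obtain ⟨K, hK⟩ := hU.bounded T
    refine ⟨C * K, fun t ht x => ?_⟩
    rw [abs_mul]
    exact mul_le_mul (hC x) (hK t ht x) (abs_nonneg _) ((abs_nonneg _).trans (hC x))

lemma sub (hU : TimeRegular U) (hV : TimeRegular V) : TimeRegular fun t x => U t x - V t x where
  measurable t := (hU.measurable t).sub (hV.measurable t)
  continuous x := (hU.continuous x).sub (hV.continuous x)
  bounded T := by
    obtain ⟨K, hK⟩ := hU.bounded T
    obtain ⟨K', hK'⟩ := hV.bounded T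
    exact ⟨K + K', fun t ht x => (abs_sub _ _).trans (add_le_add (hK t ht x) (hK' t ht x))⟩

lemma const (c : ℝ) : TimeRegular fun (_ : ℝ) (_ : E) => c where
  measurable _ := measurable_const
  continuous _ := continuous_const
  bounded _ := ⟨|c|, fun _ _ _ => le_rfl⟩

lemma primitive (hU : TimeRegular U) : TimeRegular fun t x => ∫ s in (0 : ℝ)..t, U s x where
  measurable t := by
    have h : Measurable fun q : E × ℝ => U q.2 q.1 :=
      hU.measurable_uncurry.comp measurable_swap
    have h1 : ∀ ν : Measure ℝ, SFinite ν → Measurable fun x => ∫ s, U s x ∂ν := fun ν _ =>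
      (h.stronglyMeasurable.integral_prod_right').measurable
    exact (h1 _ inferInstance).sub (h1 _ inferInstance)
  continuous x := intervalIntegral.continuous_primitive
    (fun a b => (hU.continuous x).intervalIntegrable a b) 0
  bounded T := by
    obtain ⟨K, hK⟩ := hU.bounded T
    refine ⟨|K| * |T|, fun t ht x => ?_⟩
    have hT := (abs_nonneg t).trans ht
    have hpt : ∀ s ∈ Set.uIoc 0 t, ‖U s x‖ ≤ |K| := fun s hs => by
      have h1 := Set.abs_sub_left_of_mem_uIcc (Set.uIoc_subset_uIcc hs)
      rw [sub_zero, sub_zero] at h1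
      exact (hK s (h1.trans ht) x).trans (le_abs_self _)
    refine (intervalIntegral.norm_integral_le_of_norm_le_const hpt).trans ?_
    rw [sub_zero, abs_of_nonneg hT]
    exact mul_le_mul_of_nonneg_left ht (abs_nonneg _)

end TimeRegular

/-! ### Backward and forward equations -/

variable {E : Type*} [TopologicalSpace E] [MeasurableSpace E]

namespace JumpRates

variable (M : JumpRates E) {g : E × E →ᵇ ℝ} {h : E →ᵇ ℝ} {k : ℝ}

instance (x : E) : IsFiniteMeasure (M.W x) := by
  unfold W
  exact (M.jump x).smul_finite ENNReal.ofReal_ne_top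

/-- The right-hand side is the tilted generator applied to the constant 1; this is the only way in
which the potential enters the forward equation. -/
lemma potential_eq (x : E) : M.potential g h k x =
    M.tiltedJump g k (fun _ => 1) x + M.holdingRate h k x := by
  simp only [potential, tiltedRate, tiltedJump, holdingRate, mul_one]
  ring

lemma abs_holdingRate_le (x : E) : |M.holdingRate h k x| ≤ |k| * ‖h‖ + ‖M.rate‖ := by
  refine (abs_sub _ _).trans (add_le_add ?_ (M.rate.norm_coe_le_norm x))
  rw [abs_mul]
  exact mul_le_mul_of_nonneg_left (h.norm_coe_le_norm x) (abs_nonneg k)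

variable (h) in
lemma abs_potential_le (x : E) :
    |M.potential g h k x| ≤ M.jumpBound g k * 1 + (|k| * ‖h‖ + ‖M.rate‖) := by
  rw [potential_eq]
  exact (abs_add_le _ _).trans (add_le_add (M.abs_tiltedJump_le (fun _ => by simp) x)
    (M.abs_holdingRate_le x))

/-- Measurability is what carries nonexplosion from every `ℙ_x` to the mixture `ℙ_{μ₀}`. -/
lemma measurableSet_nonexplosive [OpensMeasurableSpace E] : MeasurableSet {z | M.Nonexplosive z} := by
  have heq : {z | M.Nonexplosive z} = (⋂ n, {z : ℕ → E × ℝ | 0 < (z n).2}) ∩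
      {z | Tendsto (fun n => M.jumpTime z n) atTop atTop} := by
    ext z
    simp only [Set.mem_inter_iff, Set.mem_iInter, Set.mem_ofPred_eq]
    exact ⟨fun hz => ⟨hz.1, hz.2⟩, fun hz => ⟨hz.1, hz.2⟩⟩
  rw [heq]
  exact (MeasurableSet.iInter fun n => measurableSet_lt measurable_const (by fun_prop)).inter
    (measurableSet_tendsto _ M.measurable_jumpTime)

lemma ae_lawFrom_weight_eq [T2Space E] [OpensMeasurableSpace E] (μ₀ : Measure E)
    (hg : ∀ x, g (x, x) = 0) {t : ℝ} (ht : 0 ≤ t) :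
    ∀ᵐ z ∂(M.lawFrom μ₀), M.weight g h k t z = Real.exp (k * M.jumpSum g h t z) := by
  have hae : ∀ᵐ z ∂(M.lawFrom μ₀), M.Nonexplosive z :=
    Measure.ae_comp_of_ae_ae M.measurableSet_nonexplosive (ae_of_all _ M.ae_nonexplosive)
  filter_upwards [hae] with z hz using hz.weight_eq hg h k ht

variable (g h k) in
/-- The tilted semigroup, extended to negative times by its value at time `0`. -/
def flow (f : E → ℝ) (t : ℝ) (x : E) : ℝ := M.tiltedMean g h k f (max t 0) x

lemma nu_eq_integral_flow [T2Space E] (μ₀ : Measure E) (hg : ∀ x, g (x, x) = 0) {t : ℝ} (ht : 0 ≤ t) (f : E → ℝ) :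
    M.nu g h k μ₀ t f = ∫ x, M.flow g h k f t x ∂μ₀ := by
  simp only [nu, flow, max_eq_left ht, M.tiltedSemigroup_eq hg ht]

variable [PolishSpace E] [BorelSpace E]

variable (h) in
lemma measurable_potential : Measurable (M.potential g h k) := by
  have h1 : Measurable (M.tiltedJump g k fun _ => 1) :=
    (M.measurable_tiltedJump (F := fun _ => 1) measurable_const).comp
      ((measurable_const (a := (0 : ℝ))).prodMk measurable_id)
  have h2 : Measurable h := h.continuous.measurable
  have h3 := M.measurable_rate
  rw [funext M.potential_eq]
  unfold holdingRate
  fun_prop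

lemma timeRegular_weighted {U : ℝ → E → ℝ} (hU : TimeRegular U) (x : E) :
    TimeRegular fun t y => Real.exp (k * g (x, y)) * U t y := by
  have hg : Measurable g := g.continuous.measurable
  refine hU.mul_left (φ := fun y => Real.exp (k * g (x, y))) (by fun_prop)
    (C := Real.exp (|k| * ‖g‖)) fun y => ?_
  rw [abs_of_pos (Real.exp_pos _)]
  refine Real.exp_le_exp.2 ((le_abs_self _).trans ?_)
  rw [abs_mul]
  exact mul_le_mul_of_nonneg_left (g.norm_coe_le_norm _) (abs_nonneg k)

lemma continuous_tiltedJump {U : ℝ → E → ℝ} (hU : TimeRegular U) (x : E) :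
    Continuous fun t => M.tiltedJump g k (U t) x :=
  (timeRegular_weighted hU x).continuous_integral (M.W x)

lemma tiltedJump_sub {U V : ℝ → E → ℝ} (hU : TimeRegular U) (hV : TimeRegular V) (t : ℝ) (x : E) :
    M.tiltedJump g k (fun y => U t y - V t y) x =
      M.tiltedJump g k (U t) x - M.tiltedJump g k (V t) x := by
  simp only [tiltedJump, mul_sub]
  exact integral_sub ((timeRegular_weighted hU x).integrable t _)
    ((timeRegular_weighted hV x).integrable t _)

lemma tiltedJump_primitive {U : ℝ → E → ℝ} (hU : TimeRegular U) (t : ℝ) (x : E) :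
    M.tiltedJump g k (fun y => ∫ s in (0 : ℝ)..t, U s y) x =
      ∫ s in (0 : ℝ)..t, M.tiltedJump g k (U s) x := by
  simp only [tiltedJump, ← intervalIntegral.integral_const_mul]
  exact (timeRegular_weighted hU x).integral_intervalIntegral (M.W x) t

variable {f : E → ℝ} {b : ℝ}

lemma bounded_flow (hb : ∀ x, |f x| ≤ b) (T : ℝ) :
    ∃ C, ∀ t, |t| ≤ T → ∀ x, |M.flow g h k f t x| ≤ C := by
  refine ⟨|b| * (2 * Real.exp (M.growth g h k * T)), fun t ht x => ?_⟩
  refine (M.abs_tiltedMean_le (fun y => (hb y).trans (le_abs_self b)) (le_max_right t 0) x).trans ?_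
  have := M.growth_nonneg g h k
  have : max t 0 ≤ T := max_le ((le_abs_self t).trans ht) ((abs_nonneg t).trans ht)
  gcongr

lemma measurable_flow (hf : Measurable f) : Measurable fun p : ℝ × E => M.flow g h k f p.1 p.2 :=
  (M.measurable_tiltedMean hf).comp
    ((measurable_fst.max measurable_const).prodMk measurable_snd)

/-- Continuity of the flow in time is not yet available here; joint measurability and local bounds
suffice, and continuity is then deduced from the integral formula. -/
lemma intervalIntegrable_tiltedJump_flow (hf : Measurable f) (hb : ∀ x, |f x| ≤ b) (x : E)
    (s t : ℝ) : IntervalIntegrable (fun q => M.tiltedJump g k (M.flow g h k f q) x) volume s t := by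
  refine intervalIntegrable_of_bounded ((M.measurable_tiltedJump (M.measurable_flow hf)).comp
    (measurable_id.prodMk measurable_const)) (fun T => ?_) s t
  obtain ⟨C, hC⟩ := M.bounded_flow (g := g) (h := h) (k := k) hb T
  exact ⟨M.jumpBound g k * C, fun q hq => M.abs_tiltedJump_le (hC q hq) x⟩

variable (g h k) in
/-- The right-hand side of the variation of constants formula for the tilted semigroup. -/
def duhamel (f : E → ℝ) (t : ℝ) (x : E) : ℝ :=
  Real.exp (M.holdingRate h k x * t) * (f x + ∫ q in (0 : ℝ)..t,
    Real.exp (-(M.holdingRate h k x * q)) * M.tiltedJump g k (M.flow g h k f q) x)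

/-- Reflecting `s ↦ t - s` in the renewal integral moves `t` out of the integrand, which makes the
formula differentiable in time. -/
lemma flow_eq_duhamel (hf : Measurable f) (hb : ∀ x, |f x| ≤ b) {t : ℝ} (ht : 0 ≤ t) (x : E) :
    M.flow g h k f t x = M.duhamel g h k f t x := by
  rw [flow, max_eq_left ht, M.tiltedMean_renewal hf hb ht x, duhamel, mul_add, mul_comm (f x),
    ← intervalIntegral.integral_const_mul]
  congr 1
  have := intervalIntegral.integral_comp_sub_left (a := 0) (b := t) (fun q =>
    Real.exp (M.holdingRate h k x * (t - q)) * M.tiltedJump g k (M.tiltedMean g h k f q) x) t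
  simp only [sub_sub_cancel, sub_self, sub_zero] at this
  rw [this]
  refine intervalIntegral.integral_congr fun q hq => ?_
  rw [Set.uIcc_of_le ht] at hq
  have hflow : M.flow g h k f q = M.tiltedMean g h k f q := by
    funext y
    rw [flow, max_eq_left hq.1]
  simp only [hflow]
  rw [← mul_assoc, ← Real.exp_add]
  ring_nf

lemma continuous_duhamel (hf : Measurable f) (hb : ∀ x, |f x| ≤ b) (x : E) :
    Continuous fun t => M.duhamel g h k f t x := by
  have hexp : Continuous fun q => Real.exp (-(M.holdingRate h k x * q)) := by fun_prop
  have hint : ∀ s t, IntervalIntegrable (fun q => Real.exp (-(M.holdingRate h k x * q)) *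
      M.tiltedJump g k (M.flow g h k f q) x) volume s t := fun s t =>
    (M.intervalIntegrable_tiltedJump_flow hf hb x s t).continuousOn_mul hexp.continuousOn
  have hexp' : Continuous fun t => Real.exp (M.holdingRate h k x * t) := by fun_prop
  exact hexp'.mul (continuous_const.add (intervalIntegral.continuous_primitive hint 0))

lemma flow_eq_duhamel_max (hf : Measurable f) (hb : ∀ x, |f x| ≤ b) (t : ℝ) (x : E) :
    M.flow g h k f t x = M.duhamel g h k f (max t 0) x := by
  rw [← M.flow_eq_duhamel hf hb (le_max_right t 0) x]
  simp only [flow, max_eq_left (le_max_right t 0)]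

lemma continuous_flow (hf : Measurable f) (hb : ∀ x, |f x| ≤ b) (x : E) :
    Continuous fun t => M.flow g h k f t x := by
  rw [funext fun t => M.flow_eq_duhamel_max (g := g) (h := h) (k := k) hf hb t x]
  exact Continuous.comp (g := fun t => M.duhamel g h k f t x) (f := fun t => max t 0)
    (M.continuous_duhamel hf hb x) (continuous_id.max continuous_const)

lemma timeRegular_flow (hf : Measurable f) (hb : ∀ x, |f x| ≤ b) :
    TimeRegular (M.flow g h k f) where
  measurable _ := Measurable.of_uncurry_left (f := M.flow g h k f) (M.measurable_flow hf)
  continuous := M.continuous_flow hf hb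
  bounded := M.bounded_flow hb

/-- Stated for `duhamel`, which is differentiable on the whole line; `flow` is frozen at negative
times and may have a kink at 0. -/
lemma hasDerivAt_duhamel (hf : Measurable f) (hb : ∀ x, |f x| ≤ b) (t : ℝ) (x : E) :
    HasDerivAt (fun t => M.duhamel g h k f t x) (M.holdingRate h k x * M.duhamel g h k f t x +
      M.tiltedJump g k (M.flow g h k f t) x) t := by
  have hw := M.continuous_tiltedJump (g := g) (k := k)
    (M.timeRegular_flow (g := g) (h := h) (k := k) hf hb) x
  have hw' : Continuous fun q =>
      Real.exp (-(M.holdingRate h k x * q)) * M.tiltedJump g k (M.flow g h k f q) x :=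
    Continuous.mul (by fun_prop) hw
  have h1 := (hw'.integral_hasStrictDerivAt 0 t).hasDerivAt.const_add (f x)
  have h2 : HasDerivAt (fun t => Real.exp (M.holdingRate h k x * t))
      (Real.exp (M.holdingRate h k x * t) * (M.holdingRate h k x * 1)) t :=
    ((hasDerivAt_id t).const_mul _).exp
  refine (h2.mul h1).congr_deriv ?_
  rw [← mul_assoc (Real.exp _) (Real.exp _), ← Real.exp_add, add_neg_cancel, Real.exp_zero, one_mul,
    duhamel]
  ring

/-- The integrated backward equation for the tilted semigroup. -/
lemma flow_eq_add_integral (hf : Measurable f) (hb : ∀ x, |f x| ≤ b) {t : ℝ} (ht : 0 ≤ t) (x : E) :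
    M.flow g h k f t x = f x + ∫ s in (0 : ℝ)..t, (M.holdingRate h k x * M.flow g h k f s x +
      M.tiltedJump g k (M.flow g h k f s) x) := by
  have hU := M.timeRegular_flow (g := g) (h := h) (k := k) hf hb
  have hd := fun s => M.hasDerivAt_duhamel (g := g) (h := h) (k := k) hf hb s x
  have hcont : Continuous fun t => M.duhamel g h k f t x :=
    continuous_iff_continuousAt.2 fun s => (hd s).continuousAt
  have h1 := intervalIntegral.integral_eq_sub_of_hasDerivAt (a := 0) (b := t) (fun s _ => hd s)
    (Continuous.intervalIntegrable ((hcont.const_mul _).add (M.continuous_tiltedJump hU x)) 0 t)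
  have h0 : M.duhamel g h k f 0 x = f x := by simp [duhamel]
  rw [M.flow_eq_duhamel hf hb ht, ← sub_eq_iff_eq_add', ← h0, ← h1]
  refine intervalIntegral.integral_congr fun s hs => ?_
  rw [Set.uIcc_of_le ht] at hs
  simp only [M.flow_eq_duhamel hf hb hs.1 x]

/-- The integrated forward equation for the total mass, `∂ₜ P_k(t) 1 = P_k(t) V_k`. -/
lemma flow_one_eq (t : ℝ) (ht : 0 ≤ t) (x : E) : M.flow g h k (fun _ => 1) t x =
    1 + ∫ s in (0 : ℝ)..t, M.flow g h k (M.potential g h k) s x := by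
  have hone : ∀ x : E, |(fun _ => (1 : ℝ)) x| ≤ 1 := fun _ => by simp
  have hV := M.measurable_potential (g := g) (k := k) h
  have hVb := M.abs_potential_le (g := g) (k := k) h
  have hU1 := M.timeRegular_flow (g := g) (h := h) (k := k)
    (measurable_const : Measurable fun _ : E => (1 : ℝ)) hone
  have hUV := M.timeRegular_flow (g := g) (h := h) (k := k) hV hVb
  have hF := hUV.primitive
  set F : ℝ → E → ℝ := fun t x => ∫ s in (0 : ℝ)..t, M.flow g h k (M.potential g h k) s x with hFdef
  -- The defect in the claimed identity, to be shown to vanish.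
  let D : ℝ → E → ℝ := fun t x => M.flow g h k (fun _ => 1) t x - 1 - F t x
  have hD : TimeRegular D := (hU1.sub (TimeRegular.const 1)).sub hF
  have hBD : ∀ s x, M.tiltedJump g k (D s) x = M.tiltedJump g k (M.flow g h k (fun _ => 1) s) x -
      M.tiltedJump g k (fun _ => 1) x - M.tiltedJump g k (F s) x := fun s x => by
    rw [← M.tiltedJump_sub hU1 (TimeRegular.const 1) s x,
      ← M.tiltedJump_sub (hU1.sub (TimeRegular.const 1)) hF s x]
  -- The backward equation for `f = V_k`, with the time integral pulled through the generator by
  -- Fubini.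
  have hFeq : ∀ s, 0 ≤ s → ∀ x, M.flow g h k (M.potential g h k) s x = M.potential g h k x +
      (M.holdingRate h k x * F s x + M.tiltedJump g k (F s) x) := fun s hs x => by
    rw [M.flow_eq_add_integral hV hVb hs x, intervalIntegral.integral_add,
      intervalIntegral.integral_const_mul, ← M.tiltedJump_primitive hUV]
    · exact ((hUV.continuous x).const_mul _).intervalIntegrable _ _
    · exact (M.continuous_tiltedJump hUV x).intervalIntegrable _ _
  -- The inhomogeneous terms cancel because the generator maps 1 to `V_k`, so `D` solves a
  -- homogeneous linear equation with initial value 0.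
  have hDeq : ∀ t, 0 ≤ t → ∀ x, D t x =
      ∫ s in (0 : ℝ)..t, (M.holdingRate h k x * D s x + M.tiltedJump g k (D s) x) := by
    intro t ht x
    simp only [D, hFdef]
    rw [M.flow_eq_add_integral measurable_const hone ht x, add_sub_cancel_left,
      ← intervalIntegral.integral_sub]
    · refine intervalIntegral.integral_congr fun s hs => ?_
      rw [Set.uIcc_of_le ht] at hs
      have h1 := hBD s x
      simp only [D, hFdef] at h1
      simp only [h1]
      rw [hFeq s hs.1 x, M.potential_eq]
      ring
    · exact (((hU1.continuous x).const_mul _).add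
        (M.continuous_tiltedJump hU1 x)).intervalIntegrable _ _
    · exact (hUV.continuous x).intervalIntegrable _ _
  -- A bound for the supremum norm of the generator.
  set L := |k| * ‖h‖ + ‖M.rate‖ + M.jumpBound g k with hL
  obtain ⟨K, hK⟩ := hD.bounded t
  -- Picard iteration: each pass through the integral equation raises the power of `L s` by one and
  -- divides by `n + 1`.
  have hbound : ∀ n : ℕ, ∀ s, 0 ≤ s → s ≤ t → ∀ y, |D s y| ≤ K * ((L * s) ^ n / n.factorial) := by
    intro n
    induction n with
    | zero =>
      intro s hs hst y
      simpa using hK s (by rwa [abs_of_nonneg hs]) y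
    | succ n ih =>
      intro s hs hst y
      have hstep : ∀ r ∈ Set.Ioc 0 s,
          ‖M.holdingRate h k y * D r y + M.tiltedJump g k (D r) y‖ ≤
            K * L ^ (n + 1) / n.factorial * r ^ n := fun r hr => by
        have hr' := ih r hr.1.le (hr.2.trans hst)
        refine (norm_add_le _ _).trans ?_
        rw [norm_mul]
        refine (add_le_add (mul_le_mul (M.abs_holdingRate_le y) (hr' y) (abs_nonneg _)
          (by positivity)) (M.abs_tiltedJump_le hr' y)).trans (le_of_eq ?_)
        rw [← add_mul, ← hL]
        ring_nf
      rw [hDeq s hs y]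
      refine (intervalIntegral.norm_integral_le_of_norm_le hs (ae_of_all _ hstep)
        (Continuous.intervalIntegrable (by fun_prop) _ _)).trans (le_of_eq ?_)
      rw [intervalIntegral.integral_const_mul, integral_pow, Nat.factorial_succ]
      push_cast
      field_simp
      ring_nf
  have hlim : Tendsto (fun n : ℕ => K * ((L * t) ^ n / n.factorial)) atTop (𝓝 (K * 0)) :=
    (FloorSemiring.tendsto_pow_div_factorial_atTop (L * t)).const_mul K
  have hzero : |D t x| ≤ K * 0 := ge_of_tendsto' hlim fun n => hbound n t ht le_rfl x
  rw [mul_zero] at hzero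
  have := abs_eq_zero.1 (le_antisymm hzero (abs_nonneg _))
  simp only [D] at this
  linarith

/-! ### Total mass under the initial distribution, and its growth rate -/

variable (μ₀ : Measure E) [IsProbabilityMeasure μ₀]

instance : IsProbabilityMeasure (M.lawFrom μ₀) := by
  unfold lawFrom
  infer_instance

lemma integrable_lawFrom_exp_jumpSum {t : ℝ} (ht : 0 ≤ t) :
    Integrable (fun z => Real.exp (k * M.jumpSum g h t z)) (M.lawFrom μ₀) := by
  have hm : Measurable fun z => Real.exp (k * M.jumpSum g h t z) :=
    Real.measurable_exp.comp (((M.measurable_jumpSum g h).comp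
      (measurable_const.prodMk measurable_id)).const_mul k)
  refine ⟨hm.aestronglyMeasurable, ?_⟩
  rw [hasFiniteIntegral_iff_ofReal (ae_of_all _ fun z => (Real.exp_pos _).le), lawFrom,
    Measure.lintegral_bind M.pathLaw.measurable.aemeasurable hm.ennreal_ofReal.aemeasurable]
  refine (lintegral_mono fun x => M.lintegral_exp_jumpSum_le g h k ht x).trans_lt ?_
  rw [lintegral_const, measure_univ, mul_one]
  exact ENNReal.ofReal_lt_top

lemma integrable_weight (hg : ∀ x, g (x, x) = 0) {t : ℝ} (ht : 0 ≤ t) :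
    Integrable (M.weight g h k t) (M.lawFrom μ₀) :=
  (M.integrable_lawFrom_exp_jumpSum μ₀ ht).congr
    ((M.ae_lawFrom_weight_eq μ₀ hg ht).mono fun _ hz => hz.symm)

lemma integral_weight_pos (hg : ∀ x, g (x, x) = 0) {t : ℝ} (ht : 0 ≤ t) :
    0 < ∫ z, M.weight g h k t z ∂(M.lawFrom μ₀) := by
  rw [integral_congr_ae (M.ae_lawFrom_weight_eq μ₀ hg ht)]
  exact integral_exp_pos (M.integrable_lawFrom_exp_jumpSum μ₀ ht)

lemma integral_weight_eq_nu (hg : ∀ x, g (x, x) = 0) {t : ℝ} (ht : 0 ≤ t) :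
    ∫ z, M.weight g h k t z ∂(M.lawFrom μ₀) = M.nu g h k μ₀ t fun _ => 1 := by
  rw [lawFrom, integral_bind_kernel (M.integrable_weight μ₀ hg ht), nu]
  simp only [tiltedSemigroup, one_mul]

/-- The total mass of `ν_t` and the integral of `V_k` are related by
`log ν_t(1) = ∫_0^t μ_s(V_k) ds`. -/
lemma log_nu_one_eq (hg : ∀ x, g (x, x) = 0) {t : ℝ} (ht : 0 ≤ t) :
    IntervalIntegrable (fun s => M.mu g h k μ₀ s (M.potential g h k)) volume 0 t ∧
    Real.log (M.nu g h k μ₀ t fun _ => 1) =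
      ∫ s in (0 : ℝ)..t, M.mu g h k μ₀ s (M.potential g h k) := by
  have hUV := M.timeRegular_flow (g := g) (h := h) (k := k)
    (M.measurable_potential (g := g) (k := k) h) (M.abs_potential_le (g := g) (k := k) h)
  let v : ℝ → ℝ := fun s => ∫ x, M.flow g h k (M.potential g h k) s x ∂μ₀
  have hv : Continuous v := hUV.continuous_integral μ₀
  -- An extension of `ν_s(1)` to all real `s`, so that two-sided derivatives exist at 0 as well.
  let m : ℝ → ℝ := fun s => 1 + ∫ r in (0 : ℝ)..s, v r
  have hmd : ∀ s, HasDerivAt m (v s) s := fun s =>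
    (hv.integral_hasStrictDerivAt 0 s).hasDerivAt.const_add 1
  have hnu : ∀ s, 0 ≤ s → M.nu g h k μ₀ s (fun _ => 1) = m s := fun s hs => by
    rw [M.nu_eq_integral_flow μ₀ hg hs]
    simp only [M.flow_one_eq s hs]
    rw [integral_add (integrable_const _) (hUV.primitive.integrable s μ₀),
      hUV.integral_intervalIntegral μ₀ s]
    simp [m, v]
  have hpos : ∀ s, 0 ≤ s → 0 < m s := fun s hs => by
    rw [← hnu s hs, ← M.integral_weight_eq_nu μ₀ hg hs]
    exact M.integral_weight_pos μ₀ hg hs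
  have hmu : ∀ s ∈ Set.uIcc 0 t, v s / m s = M.mu g h k μ₀ s (M.potential g h k) := fun s hs => by
    rw [Set.uIcc_of_le ht] at hs
    rw [mu, hnu s hs.1, M.nu_eq_integral_flow μ₀ hg hs.1]
  have hmc : Continuous m := continuous_iff_continuousAt.2 fun s => (hmd s).continuousAt
  have hint : IntervalIntegrable (fun s => v s / m s) volume 0 t := by
    refine ContinuousOn.intervalIntegrable (hv.continuousOn.div hmc.continuousOn fun s hs => ?_)
    rw [Set.uIcc_of_le ht] at hs
    exact (hpos s hs.1).ne'
  refine ⟨hint.congr fun s hs => hmu s (Set.uIoc_subset_uIcc hs), ?_⟩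
  rw [hnu t ht, ← intervalIntegral.integral_congr hmu,
    intervalIntegral.integral_eq_sub_of_hasDerivAt (f := fun s => Real.log (m s)) _ hint]
  · simp [m]
  · intro s hs
    rw [Set.uIcc_of_le ht] at hs
    exact (hmd s).log (hpos s hs.1).ne'

/-- Asymptotic stability identifies the exponential growth rate of the total mass of `ν_T`. -/
lemma tendsto_log_nu_one (hg : ∀ x, g (x, x) = 0) {Λ : ℝ} (hΛ : M.AsymptoticallyStable g h k Λ) :
    Tendsto (fun T : ℝ => 1 / T * Real.log (M.nu g h k μ₀ T fun _ => 1)) atTop (𝓝 Λ) := by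
  obtain ⟨r, μinf, α, ρ, hr, hμinf, hα, hρ0, hρ1, hst⟩ := hΛ
  have hrint : Integrable r μ₀ := r.integrable μ₀
  have hrpos : 0 < ∫ x, r x ∂μ₀ := by
    rw [integral_pos_iff_support_of_nonneg (fun x => (hr x).le) hrint]
    have : Function.support r = Set.univ := Set.eq_univ_of_forall fun x => (hr x).ne'
    simp [this]
  have hone : ∀ x : E, |(fun _ => (1 : ℝ)) x| ≤ 1 := fun _ => by simp
  have hU1 := M.timeRegular_flow (g := g) (h := h) (k := k)
    (measurable_const : Measurable fun _ : E => (1 : ℝ)) hone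
  -- The stability bound for `f = 1` is uniform in `x`, so it survives integration against `μ₀`.
  have hdiff : ∀ T : ℝ, 0 ≤ T →
      |Real.exp (-(T * Λ)) * M.nu g h k μ₀ T (fun _ => 1) - ∫ x, r x ∂μ₀| ≤
        ‖(1 : E →ᵇ ℝ)‖ * (α * ρ ^ T) := fun T hT => by
    rw [M.nu_eq_integral_flow μ₀ hg hT, ← integral_const_mul,
      ← integral_sub ((hU1.integrable T μ₀).const_mul _) hrint]
    have hpt : ∀ x, ‖Real.exp (-(T * Λ)) * M.flow g h k (fun _ => 1) T x - r x‖ ≤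
        ‖(1 : E →ᵇ ℝ)‖ * (α * ρ ^ T) := fun x => by
      have := hst T hT 1 x
      have hflow : M.flow g h k (fun _ => 1) T x = M.tiltedMean g h k (1 : E →ᵇ ℝ) T x := by
        rw [flow, max_eq_left hT]
        rfl
      have hmass : ∫ y, (1 : E →ᵇ ℝ) y ∂μinf = 1 := by simp
      rw [M.tiltedSemigroup_eq hg hT, hmass, one_mul] at this
      rwa [hflow]
    have hle := norm_integral_le_of_norm_le_const (μ := μ₀) (ae_of_all _ hpt)
    rwa [probReal_univ, mul_one] at hle
  have hlim : Tendsto (fun T : ℝ => Real.exp (-(T * Λ)) * M.nu g h k μ₀ T fun _ => 1) atTop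
      (𝓝 (∫ x, r x ∂μ₀)) := by
    rw [tendsto_iff_dist_tendsto_zero]
    refine squeeze_zero' (Eventually.of_forall fun _ => dist_nonneg)
      ((eventually_ge_atTop 0).mono hdiff) ?_
    have h0 := ((tendsto_rpow_atTop_of_base_lt_one ρ (by linarith) hρ1).const_mul α).const_mul
      ‖(1 : E →ᵇ ℝ)‖
    rwa [mul_zero, mul_zero] at h0
  -- The limit `μ₀(r)` is positive, so the logarithm converges and is negligible after division by
  -- `T`.
  have hlog := (hlim.log hrpos.ne').div_atTop tendsto_id
  have hsum := hlog.add_const Λ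
  rw [zero_add] at hsum
  refine hsum.congr' ?_
  filter_upwards [eventually_gt_atTop 0] with T hT
  have hpos : 0 < M.nu g h k μ₀ T fun _ => 1 := by
    rw [← M.integral_weight_eq_nu μ₀ hg hT.le]
    exact M.integral_weight_pos μ₀ hg hT.le
  rw [Real.log_mul (Real.exp_pos _).ne' hpos.ne', Real.log_exp, id]
  field_simp
  ring

end JumpRates

end TiltedJump

end

theorem proposition5p1 {E : Type*} [TopologicalSpace E] [PolishSpace E] [LocallyCompactSpace E]
    [MeasurableSpace E] [BorelSpace E] (M : TiltedJump.JumpRates E)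
    (g : BoundedContinuousFunction (E × E) ℝ) (hg : ∀ x, g (x, x) = 0)
    (h : BoundedContinuousFunction E ℝ) (k : ℝ)
    (μ₀ : Measure E) [IsProbabilityMeasure μ₀] :
    (∀ t : ℝ, 0 ≤ t →
      Integrable (M.weight g h k t) (M.lawFrom μ₀) ∧
      IntervalIntegrable (fun s => M.mu g h k μ₀ s (M.potential g h k)) volume 0 t ∧
      Real.log (∫ z, M.weight g h k t z ∂(M.lawFrom μ₀)) =
        ∫ s in (0 : ℝ)..t, M.mu g h k μ₀ s (M.potential g h k)) ∧
    (∀ Λ : ℝ, M.AsymptoticallyStable g h k Λ →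
      M.IsSCGF g h k μ₀ Λ ∧
      Tendsto (fun T : ℝ => 1 / T * ∫ s in (0 : ℝ)..T, M.mu g h k μ₀ s (M.potential g h k))
        atTop (𝓝 Λ)) := by
  have part1 : ∀ t : ℝ, 0 ≤ t →
      Integrable (M.weight g h k t) (M.lawFrom μ₀) ∧
      IntervalIntegrable (fun s => M.mu g h k μ₀ s (M.potential g h k)) volume 0 t ∧
      Real.log (∫ z, M.weight g h k t z ∂(M.lawFrom μ₀)) =
        ∫ s in (0 : ℝ)..t, M.mu g h k μ₀ s (M.potential g h k) := fun t ht => by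
    rw [M.integral_weight_eq_nu μ₀ hg ht]
    exact ⟨M.integrable_weight μ₀ hg ht, M.log_nu_one_eq μ₀ hg ht⟩
  refine ⟨part1, fun Λ hΛ => ?_⟩
  have hlim := M.tendsto_log_nu_one μ₀ hg hΛ
  constructor
  · refine hlim.congr' ?_
    filter_upwards [eventually_ge_atTop 0] with T hT
    rw [M.integral_weight_eq_nu μ₀ hg hT]
  · refine hlim.congr' ?_
    filter_upwards [eventually_ge_atTop 0] with T hT
    rw [← M.integral_weight_eq_nu μ₀ hg hT, (part1 T hT).2.2]
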